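/- Let $m\ge 2$, let $\alpha_1,\dots,\alpha_m>0$ and $C_1,\dots,C_{m-1}\ge 0$ be constants with the $C_j$ not all zero, and let $x_1(t)<\dots<x_m(t)$ be differentiable real functions on an open set $I\subseteq\mathbb R$. For $t\in I$ let $$w(x,t)=C_j\prod_{k=1}^m|x-x_k(t)|^{\alpha_k}\quad\text{for } x_j(t)<x<x_{j+1}(t),\ 1\le j\le m-1,$$ and $w(x,t)=0$ for $x<x_1(t)$ or $x>x_m(t)$. (The $\alpha_k$ and $C_j$ do not depend on $t$.) Put $W(x)=\prod_{k=1}^m(x-x_k)$ and let $V$ be the polynomial with $\frac{2V}{W}=\sum_{k=1}^m\frac{\alpha_k}{x-x_k}$; here $'$ denotes $\partial/\partial x$ and a dot denotes $d/dt$, and the dependence on $t$ is not written. For every $t\in I$ there are orthonormal polynomials $p_n(x)=\gamma_nx^n+\cdots$, $\gamma_n>0$, $n\ge0$, for $w(\cdot,t)$, and they satisfy $$a_{n+1}p_{n+1}(x)=(x-b_n)p_n(x)-a_np_{n-1}(x)\qquad(n\ge 0)$$ with $b_n\in\mathbb R$, $a_0=0$ and $a_n>0$ for $n\ge1$ (quantities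 with index $-1$ occur only with the factor $a_0=0$). There is exactly one family of polynomials $\Omega_n$, $\Theta_n$ ($n\ge0$) with $\deg\Omega_n\le m-1$, $\deg\Theta_n\le m-2$ and, for all $n\ge 0$, $$Wp_n'=(\Omega_n-V)p_n-a_n\Theta_np_{n-1},$$ $$\Omega_{n+1}=(x-b_n)\Theta_n-\Omega_n,\qquad (x-b_n)(\Omega_{n+1}-\Omega_n)=W+a_{n+1}^2\Theta_{n+1}-a_n^2\Theta_{n-1}.$$ As functions of $t\in I$, all the quantities differentiated below are differentiable, and they satisfy the following equations, (8) and (12) for $n\ge1$, the others for $n\ge0$, and (11)–(13) for $j=1,\dots,m$: $$\frac{\dot a_n}{a_n}=\frac12\sum_{k=1}^m\frac{(\Theta_n(x_k)-\Theta_{n-1}(x_k))\,\dot x_k}{W'(x_k)},\tag{8}$$ $$\dot b_n=\sum_{k=1}^m\frac{(\Omega_{n+1}(x_k)-\Omega_n(x_k))\,\dot x_k}{W'(x_k)}=\sum_{k=1}^m\frac{((x_k-b_n)\Theta_n(x_k)-2\Omega_n(x_k))\,\dot x_k}{W'(x_k)},\tag{9}$$ $$\frac{\dot\gamma_n}{\gamma_n}=-\frac12\sum_{k=1}^m\frac{\dot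 x_k\,\Theta_n(x_k)}{W'(x_k)},\tag{10}$$ $$\frac{d}{dt}\frac{\Theta_n(x_j)}{W'(x_j)}=2\frac{\dot\gamma_n}{\gamma_n}\frac{\Theta_n(x_j)}{W'(x_j)}-2\sum_{k\ne j}\frac{\dot x_j-\dot x_k}{x_j-x_k}\,\frac{\Theta_n(x_k)\Omega_n(x_j)-\Theta_n(x_j)\Omega_n(x_k)}{W'(x_j)W'(x_k)},\tag{11}$$ $$\frac{d}{dt}\frac{\Theta_{n-1}(x_j)}{W'(x_j)}=-2\frac{\dot\gamma_{n-1}}{\gamma_{n-1}}\frac{\Theta_{n-1}(x_j)}{W'(x_j)}+2\sum_{k\ne j}\frac{\dot x_j-\dot x_k}{x_j-x_k}\,\frac{\Theta_{n-1}(x_k)\Omega_n(x_j)-\Theta_{n-1}(x_j)\Omega_n(x_k)}{W'(x_j)W'(x_k)},\tag{12}$$ $$\frac{d}{dt}\frac{\Omega_n(x_j)}{W'(x_j)}=a_n^2\sum_{k\ne j}\frac{\dot x_j-\dot x_k}{x_j-x_k}\,\frac{\Theta_n(x_j)\Theta_{n-1}(x_k)-\Theta_n(x_k)\Theta_{n-1}(x_j)}{W'(x_j)W'(x_k)}.\tag{13}$$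 -/

import Mathlib

open Polynomial

namespace GenJacobi

/-- The generalized Jacobi weight with nodes `x 0 < ⋯ < x M`, exponents `α k` and constants `c j`:
it equals `c j * ∏ k, |u - x k| ^ α k` on the `j`-th gap `(x j, x (j+1))` and vanishes outside
the gaps. -/
noncomputable def weight {M : ℕ} (α : Fin (M + 1) → ℝ) (c : Fin M → ℝ) (x : Fin (M + 1) → ℝ)
    (u : ℝ) : ℝ :=
  ∑ j : Fin M, (Set.Ioo (x j.castSucc) (x j.succ)).indicator
    (fun v => c j * ∏ k, |v - x k| ^ α k) u

/-- The nodal polynomial `W = ∏ k, (X - x k)`. -/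
noncomputable def nodal {M : ℕ} (x : Fin (M + 1) → ℝ) : ℝ[X] :=
  ∏ k, (X - C (x k))

/-- The polynomial `V` for which `2 V / W = ∑ k, α k / (X - x k)`, the logarithmic derivative
of the weight. -/
noncomputable def logDerivNum {M : ℕ} (α : Fin (M + 1) → ℝ) (x : Fin (M + 1) → ℝ) : ℝ[X] :=
  C (1 / 2) * ∑ k, C (α k) * ∏ i ∈ Finset.univ.erase k, (X - C (x i))

/-- `W' (x k)`. -/
noncomputable def nodalDeriv {M : ℕ} (x : Fin (M + 1) → ℝ) (k : Fin (M + 1)) : ℝ :=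
  (derivative (nodal x)).eval (x k)

/-- The bilinear form `∫ f g w` on polynomials. -/
noncomputable def polyInner (w : ℝ → ℝ) (f g : ℝ[X]) : ℝ :=
  ∫ u, f.eval u * g.eval u * w u

/-- The monic orthogonal polynomials of `w` (Gram–Schmidt applied to `1, X, X ^ 2, …`). -/
noncomputable def monicOrtho (w : ℝ → ℝ) : ℕ → ℝ[X]
  | n => X ^ n - ∑ k : Fin n,
      C (polyInner w (X ^ n) (monicOrtho w k) /
        polyInner w (monicOrtho w k) (monicOrtho w k)) * monicOrtho w k
  decreasing_by all_goals exact k.2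

/-- The orthonormal polynomials `p_n` of `w`. -/
noncomputable def ortho (w : ℝ → ℝ) (n : ℕ) : ℝ[X] :=
  C (Real.sqrt (polyInner w (monicOrtho w n) (monicOrtho w n)))⁻¹ * monicOrtho w n

/-- The recurrence coefficients `a_n`, with the convention `a_0 = 0`. -/
noncomputable def recA (w : ℝ → ℝ) : ℕ → ℝ
  | 0 => 0
  | n + 1 => polyInner w (X * ortho w n) (ortho w (n + 1))

/-- The recurrence coefficients `b_n`. -/
noncomputable def recB (w : ℝ → ℝ) (n : ℕ) : ℝ :=
  polyInner w (X * ortho w n) (ortho w n)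

/-- `p` is the sequence of orthonormal polynomials of `w`: exact degrees, positive leading
coefficients, and `∫ p_i p_j w = δ_ij` with convergent integrals. -/
structure IsOrthonormalSeq (w : ℝ → ℝ) (p : ℕ → ℝ[X]) : Prop where
  natDegree_eq : ∀ n, (p n).natDegree = n
  leadingCoeff_pos : ∀ n, 0 < (p n).leadingCoeff
  integrable : ∀ i j, MeasureTheory.Integrable (fun u => (p i).eval u * (p j).eval u * w u)
  inner_eq : ∀ i j, polyInner w (p i) (p j) = if i = j then 1 else 0

/-- The three-term recurrence, with `a_0 = 0` (so that `p_{-1}` plays no role; at `n = 0` the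
term written `p (n - 1)` has the factor `a 0 = 0`). -/
structure IsThreeTerm (p : ℕ → ℝ[X]) (a b : ℕ → ℝ) : Prop where
  zero : a 0 = 0
  pos : ∀ n, 0 < a (n + 1)
  recurrence : ∀ n, C (a (n + 1)) * p (n + 1) = (X - C (b n)) * p n - C (a n) * p (n - 1)

/-- `Ω` and `Θ` are the Laguerre–Freud structure polynomials, for `W` of degree `m`: the
differential relation, the two recurrences, and the degree bounds `deg Ω_n ≤ m - 1` and
`deg Θ_n ≤ m - 2`. Quantities with index `n - 1` at `n = 0` are multiplied by `a 0 = 0`. -/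
structure IsLaguerreFreud (m : ℕ) (W V : ℝ[X]) (p : ℕ → ℝ[X]) (a b : ℕ → ℝ)
    (Ω Θ : ℕ → ℝ[X]) : Prop where
  degree_Ω : ∀ n, (Ω n).degree ≤ ((m - 1 : ℕ) : WithBot ℕ)
  degree_Θ : ∀ n, (Θ n).degree ≤ ((m - 2 : ℕ) : WithBot ℕ)
  diff_rel : ∀ n, W * derivative (p n) = (Ω n - V) * p n - C (a n) * Θ n * p (n - 1)
  rec_Ω : ∀ n, Ω (n + 1) = (X - C (b n)) * Θ n - Ω n
  rec_Θ : ∀ n, (X - C (b n)) * (Ω (n + 1) - Ω n) =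
    W + C (a (n + 1) ^ 2) * Θ (n + 1) - C (a n ^ 2) * Θ (n - 1)

end GenJacobi

open GenJacobi

/-!
The proof rests on one functional per node. Let `L q = ∫ q w` and `T_k q = α_k ∫ q w / (x_k - u)`,
which converges because `α_k > 0`. Three facts about the weight are needed:

* `T_k ((x_k - X) q) = α_k L q` (`nodeFunctional_mul`);
* `∑ k, T_k q = L q'`, which is integration by parts (`sum_nodeFunctional`);
* along a motion of the nodes, `d/dt L q = ∑ k, x_k' T_k q` (`hasDerivAt_weightFunctional`).

The structure polynomials are obtained from their residues at the nodes,
`Θ_n (x_k) / W' (x_k) = T_k (p_n ^ 2)` and `Ω_n (x_k) / W' (x_k) = α_k / 2 + a_n T_k (p_n p_{n-1})`.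
The first fact and the three-term recurrence give the two recurrences at the nodes; the second
one says that the residues of `Θ_n` sum to `0` and those of `Ω_{n+1} - Ω_n` to `1`, which is what is
missing for the recurrences between polynomials and for the bound on the degree of `Θ_n`. The
differential relation follows from the recurrences by induction (`isLaguerreFreud_residuePoly`).
Two solutions differ in `Θ_n` by `D p_n ^ 2 / p_0 ^ 2` with a fixed polynomial `D`, so that the
degree bound makes the solution unique (`IsLaguerreFreud.unique`).

The derivatives of `γ_n`, `a_n` and `b_n` come from differentiating `L (p_n p_m) = δ_nm` and
`b_n = L (X p_n ^ 2)`. The system for the residues is then proved by induction on `n`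
(`hasDerivAt_residues`): differentiating the two recurrences, one finds that the equations for index
`n` imply those for `n + 1`, by partial-fraction identities between finite sums. The induction
starts from `d/dt ∫ w / (x_j - u)`, which is computed after the translation `u = v + x_j`
(`hasDerivAt_nodeFunctional_one`); after it the factor `|v| ^ (α_j - 1)` no longer depends on `t`.

The integrals have moving singularities whose derivatives are not dominated uniformly in `t`.
On each gap the weight is a product of truncated powers `(± (u - x_k))₊ ^ α_k`, and these satisfy
`|f y - f z| ≤ C |y - z| (1 + |z| ^ (α - 1))` for bounded `y` and `z`, a Lipschitz
estimate at the single point `z` with a locally integrable constant (`abs_truncPow_sub_le`). It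
suffices for differentiation under the integral sign at a given time
(`hasDerivAt_integral_prod_truncPow`).
-/

namespace GenJacobi

open MeasureTheory Set Filter Topology

/-! ### Truncated powers -/

/-- The truncated power `(σ y)₊ ^ β`; the sign `σ = ±1` selects the half-line on which it is
supported. -/
noncomputable def truncPow (β σ y : ℝ) : ℝ := (max (σ * y) 0) ^ β

lemma truncPow_nonneg (β σ y : ℝ) : 0 ≤ truncPow β σ y :=
  Real.rpow_nonneg (le_max_right _ _) _

lemma truncPow_of_nonpos {β σ y : ℝ} (hβ : 0 < β) (h : σ * y ≤ 0) : truncPow β σ y = 0 := by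
  rw [truncPow, max_eq_right h, Real.zero_rpow hβ.ne']

lemma continuous_truncPow {β : ℝ} (hβ : 0 < β) (σ : ℝ) : Continuous (truncPow β σ) := by
  unfold truncPow
  exact ((continuous_const.mul continuous_id).max continuous_const).rpow_const
    fun _ => Or.inr hβ.le

lemma abs_sign_mul {σ : ℝ} (hσ : σ = 1 ∨ σ = -1) (y : ℝ) : |σ * y| = |y| := by
  rcases hσ with rfl | rfl <;> simp

lemma truncPow_le {β σ y Q : ℝ} (hβ : 0 < β) (hσ : σ = 1 ∨ σ = -1) (hy : |y| ≤ Q) :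
    |truncPow β σ y| ≤ Q ^ β := by
  rw [abs_of_nonneg (truncPow_nonneg _ _ _)]
  refine Real.rpow_le_rpow (le_max_right _ _) (max_le ?_ ((abs_nonneg _).trans hy)) hβ.le
  exact (le_abs_self _).trans ((abs_sign_mul hσ y).le.trans hy)

lemma abs_truncPow_div_le {β σ y : ℝ} (hβ : 0 < β) (hσ : σ = 1 ∨ σ = -1) :
    |truncPow β σ y / y| ≤ |y| ^ (β - 1) := by
  rcases eq_or_ne y 0 with rfl | hy
  · simpa using Real.rpow_nonneg le_rfl _
  have h0 : 0 < |y| := abs_pos.2 hy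
  rw [abs_div, div_le_iff₀ h0, Real.rpow_sub_one h0.ne', div_mul_cancel₀ _ h0.ne']
  exact truncPow_le hβ hσ le_rfl

lemma hasDerivAt_truncPow {β σ y : ℝ} (hβ : 0 < β) (hσ : σ = 1 ∨ σ = -1) (hy : y ≠ 0) :
    HasDerivAt (truncPow β σ) (β * truncPow β σ y / y) y := by
  have hσ0 : σ ≠ 0 := by rcases hσ with rfl | rfl <;> norm_num
  have hne : σ * y ≠ 0 := mul_ne_zero hσ0 hy
  have hc : ContinuousAt (fun z => σ * z) y := by fun_prop
  rcases lt_or_gt_of_ne hne with h | h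
  · have h1 : truncPow β σ =ᶠ[𝓝 y] fun _ => 0 := by
      filter_upwards [hc.eventually_lt continuousAt_const h] with z hz
      exact truncPow_of_nonpos hβ hz.le
    rw [truncPow_of_nonpos hβ h.le, mul_zero, zero_div]
    exact (hasDerivAt_const y (0 : ℝ)).congr_of_eventuallyEq h1
  · have h1 : truncPow β σ =ᶠ[𝓝 y] fun z => (σ * z) ^ β := by
      filter_upwards [continuousAt_const.eventually_lt hc h] with z hz
      simp only [truncPow, max_eq_left hz.le]
    refine HasDerivAt.congr_of_eventuallyEq ?_ h1
    have h2 := ((hasDerivAt_id y).const_mul σ).rpow_const (p := β) (Or.inl hne)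
    refine h2.congr_deriv ?_
    rw [truncPow, max_eq_left h.le, id, Real.rpow_sub_one hne]
    field_simp

/-- A Lipschitz estimate for truncated powers *at the point* `b`: the constant depends on `b`
through a locally integrable function, and `a` may lie on either side of the singularity. -/
lemma abs_posPart_rpow_sub_le {β a b Q : ℝ} (hβ : 0 < β) (ha : |a| ≤ Q) (hb : |b| ≤ Q)
    (hb0 : b ≠ 0) :
    |(max a 0) ^ β - (max b 0) ^ β| ≤ |a - b| * (β * Q ^ (β - 1) + |b| ^ (β - 1)) := by
  have hQ : 0 ≤ Q := (abs_nonneg a).trans ha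
  have hb1 : 0 < |b| := abs_pos.2 hb0
  have hmax : |max a 0 - max b 0| ≤ |a - b| := abs_max_sub_max_le_abs a b 0
  rcases le_or_gt 1 β with h | h
  · have key : |(max a 0) ^ β - (max b 0) ^ β| ≤ β * Q ^ (β - 1) * |max a 0 - max b 0| := by
      refine Convex.norm_image_sub_le_of_norm_hasDerivWithin_le (s := Icc 0 Q)
        (f := fun y : ℝ => y ^ β) (f' := fun y => β * y ^ (β - 1)) (x := max b 0) (y := max a 0)
        (fun y _ => (Real.hasDerivAt_rpow_const (Or.inr h)).hasDerivWithinAt) ?_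
        (convex_Icc _ _) ⟨le_max_right _ _, max_le ((le_abs_self _).trans hb) hQ⟩
        ⟨le_max_right _ _, max_le ((le_abs_self _).trans ha) hQ⟩
      intro y hy
      rw [Real.norm_eq_abs, abs_of_nonneg (mul_nonneg hβ.le (Real.rpow_nonneg hy.1 _))]
      exact mul_le_mul_of_nonneg_left (Real.rpow_le_rpow hy.1 hy.2 (by linarith)) hβ.le
    have h1 : 0 ≤ β * Q ^ (β - 1) := mul_nonneg hβ.le (Real.rpow_nonneg hQ _)
    have h2 : 0 ≤ |b| ^ (β - 1) := Real.rpow_nonneg (abs_nonneg _) _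
    calc _ ≤ β * Q ^ (β - 1) * |a - b| := key.trans (mul_le_mul_of_nonneg_left hmax h1)
      _ ≤ _ := by nlinarith [abs_nonneg (a - b), mul_nonneg (abs_nonneg (a - b)) h2]
  · have h1 : 0 ≤ β * Q ^ (β - 1) := mul_nonneg hβ.le (Real.rpow_nonneg hQ _)
    suffices h2 : |(max a 0) ^ β - (max b 0) ^ β| ≤ |a - b| * |b| ^ (β - 1) by
      nlinarith [mul_nonneg (abs_nonneg (a - b)) h1]
    have hb' : |b| ^ (β - 1) = (|b| ^ (1 - β))⁻¹ := by
      rw [← Real.rpow_neg (abs_nonneg _), neg_sub]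
    have hbp : 0 < |b| ^ (1 - β) := Real.rpow_pos_of_pos hb1 _
    have hsplit : ∀ z : ℝ, 0 ≤ z → z ^ β * z ^ (1 - β) = z := fun z hz => by
      rw [← Real.rpow_add_of_nonneg hz hβ.le (by linarith), add_sub_cancel, Real.rpow_one]
    rw [hb', ← div_eq_mul_inv, le_div_iff₀ hbp]
    rcases lt_or_gt_of_ne hb0 with hb2 | hb2
    · rw [max_eq_right hb2.le, Real.zero_rpow hβ.ne', sub_zero,
        abs_of_nonneg (Real.rpow_nonneg (le_max_right _ _) _), abs_of_neg hb2]
      rcases le_or_gt a 0 with ha2 | ha2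
      · rw [max_eq_right ha2, Real.zero_rpow hβ.ne', zero_mul]; exact abs_nonneg _
      · rw [max_eq_left ha2.le, abs_of_pos (by linarith)]
        calc a ^ β * (-b) ^ (1 - β) ≤ (a - b) ^ β * (a - b) ^ (1 - β) := by
              have hb3 : 0 ≤ -b := by linarith
              have hab : 0 ≤ a - b := by linarith
              gcongr <;> linarith
          _ = a - b := hsplit _ (by linarith)
    · rw [max_eq_left hb2.le, abs_of_pos hb2]
      rw [max_eq_left hb2.le] at hmax
      refine le_trans ?_ hmax
      have hx : 0 ≤ max a 0 := le_max_right _ _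
      generalize max a 0 = x at hx
      have e : |x ^ β - b ^ β| * b ^ (1 - β) = |x ^ β * b ^ (1 - β) - b| := by
        rw [← abs_of_pos (Real.rpow_pos_of_pos hb2 (1 - β)), ← abs_mul,
          abs_of_pos (Real.rpow_pos_of_pos hb2 (1 - β)), sub_mul, hsplit b hb2.le]
      rw [e]
      have hxs := hsplit x hx
      have hbs := hsplit b hb2.le
      rcases le_total x b with hxb | hxb
      · have i1 : x ^ β * x ^ (1 - β) ≤ x ^ β * b ^ (1 - β) := by gcongr
        have i2 : x ^ β * b ^ (1 - β) ≤ b ^ β * b ^ (1 - β) := by gcongr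
        rw [abs_of_nonpos (by linarith), abs_of_nonpos (by linarith)]; linarith
      · have i1 : x ^ β * b ^ (1 - β) ≤ x ^ β * x ^ (1 - β) := by gcongr
        have i2 : b ^ β * b ^ (1 - β) ≤ x ^ β * b ^ (1 - β) := by gcongr
        rw [abs_of_nonneg (by linarith), abs_of_nonneg (by linarith)]; linarith

lemma abs_truncPow_sub_le {β σ y z Q : ℝ} (hβ : 0 < β) (hσ : σ = 1 ∨ σ = -1) (hy : |y| ≤ Q)
    (hz : |z| ≤ Q) (hz0 : z ≠ 0) :
    |truncPow β σ y - truncPow β σ z| ≤ |y - z| * (β * Q ^ (β - 1) + |z| ^ (β - 1)) := by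
  have hσ0 : σ ≠ 0 := by rcases hσ with rfl | rfl <;> norm_num
  have := abs_posPart_rpow_sub_le (a := σ * y) (b := σ * z) hβ ((abs_sign_mul hσ y).le.trans hy)
    ((abs_sign_mul hσ z).le.trans hz) (mul_ne_zero hσ0 hz0)
  rwa [← mul_sub, abs_sign_mul hσ, abs_sign_mul hσ] at this

lemma abs_prod_sub_prod_le {ι : Type*} [DecidableEq ι] (S : Finset ι) (f g : ι → ℝ) {D : ℝ}
    (hD : 1 ≤ D) (hf : ∀ i ∈ S, |f i| ≤ D) (hg : ∀ i ∈ S, |g i| ≤ D) :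
    |∏ i ∈ S, f i - ∏ i ∈ S, g i| ≤ D ^ S.card * ∑ i ∈ S, |f i - g i| := by
  induction S using Finset.induction_on with
  | empty => simp
  | insert k S hk ih =>
    rw [Finset.prod_insert hk, Finset.prod_insert hk, Finset.sum_insert hk,
      Finset.card_insert_of_notMem hk]
    have ih' := ih (fun i hi => hf i (Finset.mem_insert_of_mem hi))
      (fun i hi => hg i (Finset.mem_insert_of_mem hi))
    have hgS : |∏ i ∈ S, f i| ≤ D ^ S.card := by
      rw [Finset.abs_prod]
      exact (Finset.prod_le_prod (fun i _ => abs_nonneg _)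
        fun i hi => hf i (Finset.mem_insert_of_mem hi)).trans (Finset.prod_const D).le
    have hgk := hg k (Finset.mem_insert_self _ _)
    have hDS : D ^ S.card ≤ D ^ (S.card + 1) := pow_le_pow_right₀ hD (Nat.le_succ _)
    have e : f k * ∏ i ∈ S, f i - g k * ∏ i ∈ S, g i =
        (f k - g k) * ∏ i ∈ S, f i + g k * (∏ i ∈ S, f i - ∏ i ∈ S, g i) := by ring
    rw [e]
    calc _ ≤ |f k - g k| * |∏ i ∈ S, f i| + |g k| * |∏ i ∈ S, f i - ∏ i ∈ S, g i| := by
          rw [← abs_mul, ← abs_mul]; exact abs_add_le _ _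
      _ ≤ |f k - g k| * D ^ (S.card + 1) + D * (D ^ S.card * ∑ i ∈ S, |f i - g i|) := by
          gcongr; exact hgS.trans hDS
      _ = _ := by ring

/-! ### Integrals of products of truncated powers depending on a parameter -/

lemma integrableOn_abs_sub_rpow {r : ℝ} (hr : -1 < r) (y R : ℝ) :
    IntegrableOn (fun v => |v - y| ^ r) (Icc (-R) R) := by
  rcases lt_or_ge R 0 with hR | hR
  · rw [Icc_eq_empty (by linarith)]; exact integrableOn_empty
  have h0 : IntervalIntegrable (fun v : ℝ => |v| ^ r) volume (-R - y) (R - y) := by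
    refine intervalIntegrable_of_even (fun v => by simp) (fun c hc => ?_)
      (by simp) (by simp)
    refine (intervalIntegral.intervalIntegrable_rpow' hr).congr fun v hv => ?_
    rw [uIoc_of_le hc.le] at hv
    simp [abs_of_pos hv.1]
  have h1 := h0.comp_sub_right y (by simp)
  rw [sub_add_cancel, sub_add_cancel,
    intervalIntegrable_iff_integrableOn_Icc_of_le (by linarith)] at h1
  exact h1

/-- Logarithmic derivative of a product of truncated powers, away from the zeros of the bases. -/
lemma hasDerivAt_prod_truncPow {ι : Type*} [DecidableEq ι] (S : Finset ι) {β σ : ι → ℝ}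
    (hβ : ∀ k, 0 < β k) (hσ : ∀ k, σ k = 1 ∨ σ k = -1) {z : ι → ℝ → ℝ} {z' : ι → ℝ} {t : ℝ}
    (hz : ∀ k ∈ S, HasDerivAt (z k) (z' k) t) (h0 : ∀ k ∈ S, z k t ≠ 0) :
    HasDerivAt (fun s => ∏ k ∈ S, truncPow (β k) (σ k) (z k s))
      (∑ k ∈ S, β k * z' k * ((∏ i ∈ S, truncPow (β i) (σ i) (z i t)) / z k t)) t := by
  refine (HasDerivAt.fun_finsetProd (u := S) (f := fun k s => truncPow (β k) (σ k) (z k s))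
    (f' := fun k => β k * truncPow (β k) (σ k) (z k t) / z k t * z' k)
    fun k hk => HasDerivAt.comp (h₂ := truncPow (β k) (σ k)) (h := z k) t
      (hasDerivAt_truncPow (hβ k) (hσ k) (h0 k hk)) (hz k hk)).congr_deriv ?_
  refine Finset.sum_congr rfl fun k hk => ?_
  rw [← Finset.mul_prod_erase S _ hk, smul_eq_mul]
  ring

/-- Differentiation under the integral sign for a product of truncated powers with moving nodes
`y k s`. The factor `h` does not move and may be singular; integrability of `h` against
`|v - y k t| ^ (β k - 1)` is enough, because truncated powers satisfy a Lipschitz estimate at the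
point `t` with this function as constant. -/
theorem hasDerivAt_integral_prod_truncPow {ι : Type*} [DecidableEq ι] (S : Finset ι)
    {β σ : ι → ℝ} (hβ : ∀ k, 0 < β k) (hσ : ∀ k, σ k = 1 ∨ σ k = -1) {y : ι → ℝ → ℝ} {y' : ι → ℝ}
    {t : ℝ} (hy : ∀ k ∈ S, HasDerivAt (y k) (y' k) t) {h : ℝ → ℝ} {R : ℝ}
    (hsupp : ∀ v, R < |v| → h v = 0) (hint : Integrable h)
    (hint' : ∀ k ∈ S, Integrable fun v => h v * |v - y k t| ^ (β k - 1)) :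
    HasDerivAt (fun s => ∫ v, h v * ∏ k ∈ S, truncPow (β k) (σ k) (v - y k s))
      (∑ k ∈ S, -(β k * y' k) *
        ∫ v, h v * ((∏ i ∈ S, truncPow (β i) (σ i) (v - y i t)) / (v - y k t))) t := by
  -- uniform Lipschitz constant `K` and bound `Y` for the nodes near `t`
  obtain ⟨K, hK0, hK⟩ : ∃ K : ℝ, 0 ≤ K ∧ ∀ᶠ s in 𝓝 t, ∀ k ∈ S, |y k s - y k t| ≤ K * |s - t| := by
    have h1 : ∀ k ∈ S, ∃ K : ℝ, 0 ≤ K ∧ ∀ᶠ s in 𝓝 t, |y k s - y k t| ≤ K * |s - t| := by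
      intro k hk
      obtain ⟨K, hK0, hK⟩ := (hy k hk).isBigO_sub.exists_nonneg
      exact ⟨K, hK0, hK.bound⟩
    choose! K hK0 hK using h1
    refine ⟨∑ k ∈ S, K k, Finset.sum_nonneg hK0, ?_⟩
    rw [Filter.eventually_all_finset]
    intro k hk
    filter_upwards [hK k hk] with s hs
    exact hs.trans (mul_le_mul_of_nonneg_right
      (Finset.single_le_sum (f := K) hK0 hk) (abs_nonneg _))
  obtain ⟨Y, hY⟩ : ∃ Y : ℝ, ∀ᶠ s in 𝓝 t, ∀ k ∈ S, |y k s| ≤ Y := by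
    refine ⟨∑ k ∈ S, (|y k t| + 1), ?_⟩
    rw [Filter.eventually_all_finset]
    intro k hk
    have h1 : ContinuousAt (fun s => |y k s|) t := (hy k hk).continuousAt.abs
    filter_upwards [h1.eventually_lt continuousAt_const (lt_add_one _)] with s hs
    exact hs.le.trans (Finset.single_le_sum (f := fun k => |y k t| + 1)
      (fun i _ => by positivity) hk)
  set Q : ℝ := |R| + |Y| with hQ
  have hQv : ∀ s k v, k ∈ S → |v| ≤ R → (∀ k ∈ S, |y k s| ≤ Y) → |v - y k s| ≤ Q := by
    intro s k v hk hv hs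
    calc |v - y k s| ≤ |v| + |y k s| := abs_sub _ _
      _ ≤ |R| + |Y| := add_le_add (hv.trans (le_abs_self _)) ((hs k hk).trans (le_abs_self _))
  set D : ℝ := 1 + ∑ k ∈ S, Q ^ β k with hD
  have hQ0 : 0 ≤ Q := by positivity
  have hD1 : 1 ≤ D := le_add_of_nonneg_right (Finset.sum_nonneg fun k _ => Real.rpow_nonneg hQ0 _)
  have hDk : ∀ k ∈ S, Q ^ β k ≤ D := fun k hk => by
    have := Finset.single_le_sum (f := fun k => Q ^ β k) (fun k _ => Real.rpow_nonneg hQ0 _) hk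
    linarith
  set F : ℝ → ℝ → ℝ := fun s v => h v * ∏ k ∈ S, truncPow (β k) (σ k) (v - y k s) with hF
  set G : ℝ → ℝ := fun v => ∑ k ∈ S, -(β k * y' k) *
    (h v * ((∏ i ∈ S, truncPow (β i) (σ i) (v - y i t)) / (v - y k t))) with hG
  set bound : ℝ → ℝ := fun v => |h v| * (D ^ S.card *
    ∑ k ∈ S, K * (β k * Q ^ (β k - 1) + |v - y k t| ^ (β k - 1))) with hbound
  have hcont : ∀ s, Continuous fun v => ∏ k ∈ S, truncPow (β k) (σ k) (v - y k s) := fun s =>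
    continuous_finsetProd _ fun k _ => (continuous_truncPow (hβ k) _).comp (by fun_prop)
  have hYt := hY.self_of_nhds
  have hFle : ∀ s, (∀ k ∈ S, |y k s| ≤ Y) → ∀ v, |v| ≤ R →
      |∏ k ∈ S, truncPow (β k) (σ k) (v - y k s)| ≤ D ^ S.card := by
    intro s hs v hv
    rw [Finset.abs_prod]
    exact (Finset.prod_le_prod (fun i _ => abs_nonneg _) fun k hk =>
      (truncPow_le (hβ k) (hσ k) (hQv s k v hk hv hs)).trans (hDk k hk)).trans
      (Finset.prod_const D).le
  have hFint : Integrable (F t) := by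
    refine (hint.norm.mul_const (D ^ S.card)).mono'
      (hint.aestronglyMeasurable.mul (hcont t).aestronglyMeasurable) (ae_of_all _ fun v => ?_)
    rw [hF, norm_mul]
    rcases le_or_gt |v| R with hv | hv
    · exact mul_le_mul_of_nonneg_left (hFle t hYt v hv) (norm_nonneg _)
    · simp [hsupp v hv]
  have hterm : ∀ k ∈ S, Integrable fun v =>
      h v * ((∏ i ∈ S, truncPow (β i) (σ i) (v - y i t)) / (v - y k t)) := by
    intro k hk
    have hm : AEStronglyMeasurable (fun v : ℝ => v - y k t) :=
      (continuous_id.sub continuous_const).aestronglyMeasurable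
    refine ((hint' k hk).norm.mul_const (D ^ (S.erase k).card)).mono'
      (hint.aestronglyMeasurable.mul
        ((hcont t).measurable.div (measurable_id.sub_const _)).aestronglyMeasurable)
      (ae_of_all _ fun v => ?_)
    rcases le_or_gt |v| R with hv | hv
    · rw [← Finset.mul_prod_erase S _ hk, mul_div_right_comm, norm_mul, norm_mul, norm_mul,
        mul_assoc]
      refine mul_le_mul_of_nonneg_left (mul_le_mul ?_ ?_ (norm_nonneg _) (norm_nonneg _))
        (norm_nonneg _)
      · exact (abs_truncPow_div_le (hβ k) (hσ k)).trans (le_abs_self _)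
      · rw [Real.norm_eq_abs, Finset.abs_prod]
        exact (Finset.prod_le_prod (fun i _ => abs_nonneg _) fun i hi =>
          (truncPow_le (hβ i) (hσ i)
            (hQv t i v (Finset.mem_of_mem_erase hi) hv hYt)).trans
            (hDk i (Finset.mem_of_mem_erase hi))).trans (Finset.prod_const D).le
    · simp [hsupp v hv]
  have hGint : Integrable G := integrable_finsetSum _ fun k hk => (hterm k hk).const_mul _
  have hbint : Integrable bound := by
    have e : bound = fun v => ∑ k ∈ S, D ^ S.card * K * (β k * Q ^ (β k - 1) * |h v| +
        |h v * |v - y k t| ^ (β k - 1)|) := by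
      funext v
      simp only [hbound, Finset.mul_sum]
      refine Finset.sum_congr rfl fun k _ => ?_
      rw [abs_mul, abs_of_nonneg (Real.rpow_nonneg (abs_nonneg (v - y k t)) (β k - 1))]
      ring
    rw [e]
    exact integrable_finsetSum _ fun k hk =>
      ((hint.abs.const_mul _).add (hint' k hk).abs).const_mul _
  have hne : ∀ᵐ v : ℝ, ∀ k ∈ S, v - y k t ≠ 0 := by
    have : (⋃ k ∈ S, {y k t}).Finite := S.finite_toSet.biUnion fun k _ => finite_singleton _
    filter_upwards [this.countable.ae_notMem volume] with v hv k hk h0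
    exact hv (mem_biUnion hk (by simp [sub_eq_zero.1 h0]))
  have hderiv : HasDerivAt (fun s => ∫ v, F s v) (∫ v, G v) t := by
    let L : ℝ →L[ℝ] ℝ →L[ℝ] ℝ := ContinuousLinearMap.smulRightL ℝ ℝ ℝ 1
    have key := (hasFDerivAt_integral_of_dominated_loc_of_lip' (F := F) (F' := fun v => L (G v))
      (x₀ := t) (bound := bound) (μ := volume) (hK.and hY)
      (fun s _ => hint.aestronglyMeasurable.mul (hcont s).aestronglyMeasurable) hFint
      (L.continuous.comp_aestronglyMeasurable hGint.aestronglyMeasurable) ?_ hbint ?_).2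
    · rw [ContinuousLinearMap.integral_comp_comm _ hGint] at key
      exact hasDerivAt_iff_hasFDerivAt.2 key
    · filter_upwards [hne] with v hv s hs
      rcases le_or_gt |v| R with hvR | hvR
      · rw [hF, ← mul_sub, norm_mul, mul_assoc, Real.norm_eq_abs, Real.norm_eq_abs,
          Real.norm_eq_abs]
        refine mul_le_mul_of_nonneg_left ?_ (abs_nonneg _)
        refine (abs_prod_sub_prod_le S _ _ hD1
          (fun k hk => (truncPow_le (hβ k) (hσ k) (hQv s k v hk hvR hs.2)).trans (hDk k hk))
          (fun k hk => (truncPow_le (hβ k) (hσ k) (hQv t k v hk hvR hYt)).trans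
            (hDk k hk))).trans ?_
        rw [mul_assoc, Finset.sum_mul]
        refine mul_le_mul_of_nonneg_left (Finset.sum_le_sum fun k hk => ?_) (by positivity)
        refine (abs_truncPow_sub_le (hβ k) (hσ k) (hQv s k v hk hvR hs.2)
          (hQv t k v hk hvR hYt) (hv k hk)).trans ?_
        rw [mul_right_comm]
        refine mul_le_mul_of_nonneg_right ?_ (add_nonneg (mul_nonneg (hβ k).le
          (Real.rpow_nonneg hQ0 _)) (Real.rpow_nonneg (abs_nonneg _) _))
        rw [sub_sub_sub_cancel_left, abs_sub_comm]
        exact hs.1 k hk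
      · simp [hF, hbound, hsupp v hvR]
    · filter_upwards [hne] with v hv
      have h1 : HasDerivAt (fun s => F s v) (G v) t := by
        refine ((hasDerivAt_prod_truncPow S hβ hσ (fun k hk => (hy k hk).const_sub v)
          hv).const_mul (h v)).congr_deriv ?_
        rw [hG, Finset.mul_sum]
        exact Finset.sum_congr rfl fun k _ => by ring
      exact h1.hasFDerivAt
  rw [hG, integral_finsetSum _ fun k hk => (hterm k hk).const_mul _] at hderiv
  simpa only [integral_const_mul] using hderiv

/-! ### The weight as a sum of products of truncated powers -/

/-- The sign `±1` of `u - x k` for `u` in the gap `(x j, x (j + 1))`. -/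
noncomputable def gapSign {M : ℕ} (j : Fin M) (k : Fin (M + 1)) : ℝ :=
  if k ≤ j.castSucc then 1 else -1

lemma gapSign_eq {M : ℕ} (j : Fin M) (k : Fin (M + 1)) : gapSign j k = 1 ∨ gapSign j k = -1 := by
  unfold gapSign; split_ifs <;> simp

/-- The function `∏ k, |u - x k| ^ α k` on the gap `(x j, x (j + 1))`, extended by zero. Written
with truncated powers, it involves no indicator function, so that its dependence on the nodes can
be treated factor by factor. -/
noncomputable def gapProd {M : ℕ} (α x : Fin (M + 1) → ℝ) (j : Fin M) (u : ℝ) : ℝ :=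
  ∏ k, truncPow (α k) (gapSign j k) (u - x k)

section gap

variable {M : ℕ} {α x : Fin (M + 1) → ℝ} (hα : ∀ k, 0 < α k) {c : Fin M → ℝ}

include hα

lemma gapProd_eq_indicator (hx : StrictMono x) (j : Fin M) (u : ℝ) :
    gapProd α x j u = (Ioo (x j.castSucc) (x j.succ)).indicator
      (fun v => ∏ k, |v - x k| ^ α k) u := by
  by_cases hu : u ∈ Ioo (x j.castSucc) (x j.succ)
  · rw [indicator_of_mem hu, gapProd]
    refine Finset.prod_congr rfl fun k _ => ?_
    unfold truncPow gapSign
    split_ifs with hk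
    · have : x k ≤ x j.castSucc := hx.monotone hk
      have := hu.1
      rw [one_mul, max_eq_left (by linarith), abs_of_pos (by linarith)]
    · have : x j.succ ≤ x k := hx.monotone (by
        rw [not_le, Fin.castSucc_lt_iff_succ_le] at hk; exact hk)
      have := hu.2
      rw [max_eq_left (by linarith), abs_of_neg (by linarith)]
      ring_nf
  · rw [indicator_of_notMem hu, gapProd]
    rw [mem_Ioo, not_and_or, not_lt, not_lt] at hu
    rcases hu with hu | hu
    · refine Finset.prod_eq_zero (Finset.mem_univ j.castSucc) (truncPow_of_nonpos (hα _) ?_)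
      rw [gapSign, if_pos le_rfl]; linarith
    · refine Finset.prod_eq_zero (Finset.mem_univ j.succ) (truncPow_of_nonpos (hα _) ?_)
      rw [gapSign, if_neg (by simp)]; linarith

lemma weight_eq_sum (hx : StrictMono x) (u : ℝ) :
    weight α c x u = ∑ j, c j * gapProd α x j u := by
  unfold weight
  refine Finset.sum_congr rfl fun j _ => ?_
  rw [gapProd_eq_indicator hα hx]
  by_cases hu : u ∈ Ioo (x j.castSucc) (x j.succ)
  · rw [indicator_of_mem hu, indicator_of_mem hu]
  · rw [indicator_of_notMem hu, indicator_of_notMem hu, mul_zero]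

lemma gapProd_node (j : Fin M) (k : Fin (M + 1)) : gapProd α x j (x k) = 0 :=
  Finset.prod_eq_zero (Finset.mem_univ k) (truncPow_of_nonpos (hα k) (by simp))

lemma continuous_gapProd (j : Fin M) : Continuous (gapProd α x j) :=
  continuous_finsetProd _ fun k _ => (continuous_truncPow (hα k) _).comp (by fun_prop)

lemma gapProd_eq_zero_of_lt_abs (j : Fin M) {R u : ℝ} (hR : ∀ k, |x k| ≤ R) (hu : R < |u|) :
    gapProd α x j u = 0 := by
  rcases le_total 0 u with h | h
  · rw [abs_of_nonneg h] at hu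
    have := (le_abs_self _).trans (hR j.succ)
    refine Finset.prod_eq_zero (Finset.mem_univ j.succ) (truncPow_of_nonpos (hα _) ?_)
    rw [gapSign, if_neg (by simp)]; linarith
  · rw [abs_of_nonpos h] at hu
    have := (neg_le_abs _).trans (hR j.castSucc)
    refine Finset.prod_eq_zero (Finset.mem_univ j.castSucc) (truncPow_of_nonpos (hα _) ?_)
    rw [gapSign, if_pos le_rfl]; linarith

omit hα in
lemma exists_bound (x : Fin (M + 1) → ℝ) : ∃ R, 0 ≤ R ∧ ∀ k, |x k| ≤ R :=
  ⟨∑ k, |x k|, Finset.sum_nonneg fun _ _ => abs_nonneg _,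
    fun k => Finset.single_le_sum (f := fun k => |x k|) (fun _ _ => abs_nonneg _)
      (Finset.mem_univ k)⟩

omit hα in
lemma integrable_of_integrableOn_Icc {f : ℝ → ℝ} {R : ℝ} (hf : IntegrableOn f (Icc (-R) R))
    (h0 : ∀ u, R < |u| → f u = 0) : Integrable f := by
  refine (integrableOn_iff_integrable_of_support_subset fun u hu => ?_).1 hf
  rw [mem_Icc, ← abs_le]
  by_contra h
  exact hu (h0 u (not_le.1 h))

lemma integrable_mul_gapProd {F : ℝ → ℝ} (hF : Continuous F) (j : Fin M) :
    Integrable fun u => F u * gapProd α x j u := by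
  obtain ⟨R, -, hR⟩ := exists_bound x
  exact integrable_of_integrableOn_Icc (R := R)
    ((hF.mul (continuous_gapProd hα j)).continuousOn.integrableOn_Icc)
    fun u hu => by rw [gapProd_eq_zero_of_lt_abs hα j hR hu, mul_zero]

lemma integrable_mul_gapProd_div {F : ℝ → ℝ} (hF : Continuous F) (j : Fin M) (k : Fin (M + 1)) :
    Integrable fun u => F u * (gapProd α x j u / (x k - u)) := by
  obtain ⟨R, -, hR⟩ := exists_bound x
  refine integrable_of_integrableOn_Icc (R := R) ?_
    fun u hu => by rw [gapProd_eq_zero_of_lt_abs hα j hR hu, zero_div, mul_zero]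
  have h1 : IntegrableOn (fun u => truncPow (α k) (gapSign j k) (u - x k) / (u - x k))
      (Icc (-R) R) := by
    refine (integrableOn_abs_sub_rpow (r := α k - 1) (by linarith [hα k]) (x k) R).mono'
      ?_ (ae_of_all _ fun u => abs_truncPow_div_le (hα k) (gapSign_eq j k))
    exact (((continuous_truncPow (hα k) _).comp
      (continuous_id.sub continuous_const)).measurable.div
      (measurable_id.sub_const _)).aestronglyMeasurable
  have h2 : Continuous fun u => -F u * ∏ i ∈ Finset.univ.erase k,
      truncPow (α i) (gapSign j i) (u - x i) :=
    hF.neg.mul (continuous_finsetProd _ fun k _ =>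
      (continuous_truncPow (hα k) _).comp (by fun_prop))
  refine (h1.continuousOn_mul h2.continuousOn isCompact_Icc).congr (ae_of_all _ fun u => ?_)
  simp only [gapProd]
  rw [← Finset.mul_prod_erase _ _ (Finset.mem_univ k), ← neg_sub u (x k), div_neg]
  ring

lemma integrable_mul_weight {F : ℝ → ℝ} (hF : Continuous F) (hx : StrictMono x) :
    Integrable fun u => F u * weight α c x u := by
  simp_rw [weight_eq_sum hα hx, Finset.mul_sum, mul_left_comm (F _)]
  exact integrable_finsetSum _ fun j _ => (integrable_mul_gapProd hα hF j).const_mul _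

lemma integrable_mul_weight_div {F : ℝ → ℝ} (hF : Continuous F) (hx : StrictMono x)
    (k : Fin (M + 1)) : Integrable fun u => F u * (weight α c x u / (x k - u)) := by
  simp_rw [weight_eq_sum hα hx, Finset.sum_div, Finset.mul_sum, mul_div_assoc,
    mul_left_comm (F _)]
  exact integrable_finsetSum _ fun j _ => (integrable_mul_gapProd_div hα hF j k).const_mul _

lemma integral_mul_weight {F : ℝ → ℝ} (hF : Continuous F) (hx : StrictMono x) :
    ∫ u, F u * weight α c x u = ∑ j, c j * ∫ u, F u * gapProd α x j u := by
  simp_rw [weight_eq_sum hα hx, Finset.mul_sum, mul_left_comm (F _)]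
  rw [integral_finsetSum _ fun j _ => (integrable_mul_gapProd hα hF j).const_mul _]
  simp_rw [integral_const_mul]

lemma integral_mul_weight_div {F : ℝ → ℝ} (hF : Continuous F) (hx : StrictMono x)
    (k : Fin (M + 1)) : ∫ u, F u * (weight α c x u / (x k - u)) =
      ∑ j, c j * ∫ u, F u * (gapProd α x j u / (x k - u)) := by
  simp_rw [weight_eq_sum hα hx, Finset.sum_div, Finset.mul_sum, mul_div_assoc,
    mul_left_comm (F _)]
  rw [integral_finsetSum _ fun j _ => (integrable_mul_gapProd_div hα hF j k).const_mul _]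
  simp_rw [integral_const_mul]

/-- Integration by parts on one gap: the boundary terms vanish because the exponents are
positive. -/
lemma sum_integral_gapProd_div (q : ℝ[X]) (j : Fin M) :
    ∑ k, α k * ∫ u, q.eval u * (gapProd α x j u / (x k - u)) =
      ∫ u, (derivative q).eval u * gapProd α x j u := by
  obtain ⟨R, hR0, hR⟩ := exists_bound x
  set f' : ℝ → ℝ := fun u => (derivative q).eval u * gapProd α x j u -
    ∑ k, α k * (q.eval u * (gapProd α x j u / (x k - u))) with hf'
  have hq' := integrable_mul_gapProd hα (x := x) (derivative q).continuous j
  have hk' : ∀ k ∈ Finset.univ, Integrable fun u =>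
      α k * (q.eval u * (gapProd α x j u / (x k - u))) :=
    fun k _ => (integrable_mul_gapProd_div hα q.continuous j k).const_mul _
  have hint : Integrable f' := hq'.sub (integrable_finsetSum _ hk')
  have hR1 : ∀ k, |x k| ≤ R + 1 := fun k => (hR k).trans (by linarith)
  have h0 : ∀ u, R < |u| → gapProd α x j u = 0 := fun u => gapProd_eq_zero_of_lt_abs hα j hR
  have key := integral_eq_of_hasDerivAt_off_countable
    (fun u => q.eval u * gapProd α x j u) f' (a := -(R + 1)) (b := R + 1)
    (s := range x) (finite_range x).countable
    (q.continuous.mul (continuous_gapProd hα j)).continuousOn (fun u hu => ?_)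
    hint.intervalIntegrable
  · rw [h0 (R + 1) (by rw [abs_of_pos (by linarith)]; linarith),
      h0 (-(R + 1)) (by rw [abs_neg, abs_of_pos (by linarith)]; linarith), mul_zero, mul_zero,
      sub_zero, intervalIntegral.integral_of_le (by linarith),
      setIntegral_eq_integral_of_forall_compl_eq_zero, hf',
      integral_sub hq' (integrable_finsetSum _ hk'), integral_finsetSum _ hk'] at key
    · simp_rw [integral_const_mul] at key
      linarith
    · intro u hu
      have hu' : R < |u| := by
        by_contra h
        have := abs_le.1 (not_lt.1 h)
        exact hu ⟨by linarith, by linarith⟩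
      simp [hf', h0 u hu']
  · have h1 := hasDerivAt_prod_truncPow Finset.univ hα (gapSign_eq j)
      (z := fun k v => v - x k) (z' := fun _ => 1) (t := u)
      (fun k _ => (hasDerivAt_id u).sub_const (x k))
      (fun k _ => sub_ne_zero.2 fun h => hu.2 ⟨k, h.symm⟩)
    refine ((q.hasDerivAt u).mul h1).congr_deriv ?_
    simp only [hf', gapProd, Finset.mul_sum, sub_eq_add_neg, ← Finset.sum_neg_distrib]
    congr 1
    refine Finset.sum_congr rfl fun k _ => ?_
    rw [← sub_eq_add_neg, ← sub_eq_add_neg, ← neg_sub u (x k), div_neg]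
    ring

/-- The derivative of the moments of one gap with respect to the nodes. -/
lemma hasDerivAt_integral_gapProd (q : ℝ[X]) (j : Fin M) {y : Fin (M + 1) → ℝ → ℝ}
    {y' : Fin (M + 1) → ℝ} {t : ℝ} (hy : ∀ k, HasDerivAt (y k) (y' k) t) :
    HasDerivAt (fun s => ∫ u, q.eval u * gapProd α (fun k => y k s) j u)
      (∑ k, y' k * (α k * ∫ u, q.eval u * (gapProd α (fun k => y k t) j u / (y k t - u)))) t := by
  obtain ⟨R, hR0, hR⟩ := exists_bound fun k => y k t
  have hRs : ∀ᶠ s in 𝓝 t, ∀ k, |y k s| ≤ R + 1 := by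
    rw [Filter.eventually_all]
    intro k
    filter_upwards [(hy k).continuousAt.abs.eventually_lt continuousAt_const
      ((hR k).trans_lt (lt_add_one R))] with s hs using hs.le
  set h : ℝ → ℝ := (Icc (-(R + 1)) (R + 1)).indicator fun u => q.eval u with hh
  have hsupp : ∀ v, R + 1 < |v| → h v = 0 := fun v hv =>
    indicator_of_notMem (fun hv' => not_le.2 hv (abs_le.2 (mem_Icc.1 hv'))) _
  have hh1 : ∀ s, (∀ k, |y k s| ≤ R + 1) → ∀ g : ℝ → ℝ, ∀ u,
      h u * (gapProd α (fun k => y k s) j u / g u) =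
        q.eval u * (gapProd α (fun k => y k s) j u / g u) := by
    intro s hs g u
    by_cases hu : u ∈ Icc (-(R + 1)) (R + 1)
    · rw [hh, indicator_of_mem hu]
    · rw [mem_Icc, ← abs_le, not_le] at hu
      rw [gapProd_eq_zero_of_lt_abs hα j hs hu]; simp
  have hint : Integrable h := (integrable_indicator_iff measurableSet_Icc).2
    q.continuous.continuousOn.integrableOn_Icc
  have hint' : ∀ k ∈ Finset.univ, Integrable fun v => h v * |v - y k t| ^ (α k - 1) := by
    intro k _
    refine integrable_of_integrableOn_Icc (R := R + 1) ?_ fun u hu => by rw [hsupp u hu, zero_mul]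
    refine ((integrableOn_abs_sub_rpow (r := α k - 1) (by linarith [hα k]) (y k t)
      (R + 1)).continuousOn_mul q.continuous.continuousOn isCompact_Icc).congr_fun (fun u hu => ?_)
      measurableSet_Icc
    simp only [hh, indicator_of_mem hu]
  have key := hasDerivAt_integral_prod_truncPow Finset.univ hα (gapSign_eq j)
    (fun k _ => hy k) hsupp hint hint'
  refine (key.congr_deriv ?_).congr_of_eventuallyEq ?_
  · refine Finset.sum_congr rfl fun k _ => ?_
    have e : ∀ v, h v * ((∏ i, truncPow (α i) (gapSign j i) (v - y i t)) / (v - y k t)) =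
        -(q.eval v * (gapProd α (fun k => y k t) j v / (y k t - v))) := by
      intro v
      have := hh1 t hRs.self_of_nhds (fun v => v - y k t) v
      rw [gapProd] at this ⊢
      rw [this, ← neg_sub v, div_neg]; ring
    simp_rw [e, integral_neg]
    ring
  · filter_upwards [hRs] with s hs
    refine integral_congr_ae (ae_of_all _ fun u => ?_)
    have := hh1 s hs (fun _ => 1) u
    rw [div_one] at this
    exact this.symm

omit hα in
/-- A product of two power singularities at distinct points is dominated by their sum, because
`|y| ≤ |v| + |v - y|`. -/
lemma abs_rpow_mul_abs_sub_rpow_le {a b : ℝ} (ha : 0 < a) (hb : 0 < b) {y v Q : ℝ}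
    (hv : |v| ≤ Q) (hvy : |v - y| ≤ Q) :
    |y| * (|v| ^ (a - 1) * |v - y| ^ (b - 1)) ≤
      Q ^ a * |v - y| ^ (b - 1) + Q ^ b * |v| ^ (a - 1) := by
  have h : ∀ (r z : ℝ), 0 < r → |z| ≤ Q → |z| * |z| ^ (r - 1) ≤ Q ^ r := by
    intro r z hr hz
    rcases eq_or_ne z 0 with rfl | h0
    · simpa using Real.rpow_nonneg ((abs_nonneg _).trans hz) r
    · rw [Real.rpow_sub_one (abs_pos.2 h0).ne', mul_div_cancel₀ _ (abs_pos.2 h0).ne']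
      exact Real.rpow_le_rpow (abs_nonneg _) hz hr.le
  have h1 : |y| ≤ |v| + |v - y| := by
    have := abs_sub v (v - y); rwa [sub_sub_cancel] at this
  have p1 : 0 ≤ |v| ^ (a - 1) := Real.rpow_nonneg (abs_nonneg _) _
  have p2 : 0 ≤ |v - y| ^ (b - 1) := Real.rpow_nonneg (abs_nonneg _) _
  calc _ ≤ (|v| + |v - y|) * (|v| ^ (a - 1) * |v - y| ^ (b - 1)) := by gcongr
    _ = (|v| * |v| ^ (a - 1)) * |v - y| ^ (b - 1) +
        (|v - y| * |v - y| ^ (b - 1)) * |v| ^ (a - 1) := by ring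
    _ ≤ _ := by gcongr <;> apply h <;> assumption

/-- The derivative of the Cauchy integral of one gap at a node. The singular factor is made
stationary by the translation `u = v + y i s`; partial fractions then bring the derivative into
closed form. -/
lemma hasDerivAt_integral_gapProd_div (j : Fin M) (i : Fin (M + 1)) {y : Fin (M + 1) → ℝ → ℝ}
    {y' : Fin (M + 1) → ℝ} {t : ℝ} (hy : ∀ k, HasDerivAt (y k) (y' k) t)
    (hinj : ∀ k, k ≠ i → y k t ≠ y i t) :
    HasDerivAt (fun s => ∫ u, gapProd α (fun k => y k s) j u / (y i s - u))
      (∑ k ∈ Finset.univ.erase i, α k * ((y' i - y' k) / (y i t - y k t)) *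
        ((∫ u, gapProd α (fun k => y k t) j u / (y i t - u)) -
          ∫ u, gapProd α (fun k => y k t) j u / (y k t - u))) t := by
  obtain ⟨R, hR0, hR⟩ := exists_bound fun k => y k t - y i t
  have hRs : ∀ᶠ s in 𝓝 t, ∀ k, |y k s - y i s| ≤ R + 1 := by
    rw [Filter.eventually_all]
    intro k
    filter_upwards [((hy k).sub (hy i)).continuousAt.abs.eventually_lt continuousAt_const
      ((hR k).trans_lt (lt_add_one R))] with s hs using hs.le
  set B := Icc (-(R + 1)) (R + 1) with hB
  set h : ℝ → ℝ := B.indicator fun v => truncPow (α i) (gapSign j i) v / (-v) with hh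
  set E := Finset.univ.erase i with hE
  have hsupp : ∀ v, R + 1 < |v| → h v = 0 := fun v hv =>
    indicator_of_notMem (fun hv' => not_le.2 hv (abs_le.2 (mem_Icc.1 hv'))) _
  have hprod : ∀ s v, truncPow (α i) (gapSign j i) v *
      ∏ k ∈ E, truncPow (α k) (gapSign j k) (v - (y k s - y i s)) =
        gapProd α (fun k => y k s) j (v + y i s) := by
    intro s v
    rw [gapProd, ← Finset.mul_prod_erase _ _ (Finset.mem_univ i), add_sub_cancel_right]
    congr 1
    exact Finset.prod_congr rfl fun k _ => by congr 1; ring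
  have hh1 : ∀ s, (∀ k, |y k s - y i s| ≤ R + 1) → ∀ v,
      h v * ∏ k ∈ E, truncPow (α k) (gapSign j k) (v - (y k s - y i s)) =
        gapProd α (fun k => y k s) j (v + y i s) / (y i s - (v + y i s)) := by
    intro s hs v
    rw [← hprod, sub_add_cancel_right]
    by_cases hu : v ∈ B
    · rw [hh, indicator_of_mem hu]; ring
    · rw [hB, mem_Icc, ← abs_le, not_le] at hu
      have h0 : gapProd α (fun k => y k s - y i s) j v = 0 := gapProd_eq_zero_of_lt_abs hα j hs hu
      rw [gapProd, ← Finset.mul_prod_erase _ _ (Finset.mem_univ i), sub_self, sub_zero] at h0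
      rw [hsupp v hu, h0]; simp
  have hmeas : AEStronglyMeasurable h :=
    ((((continuous_truncPow (hα i) (gapSign j i)).measurable).div measurable_neg).indicator
      measurableSet_Icc).aestronglyMeasurable
  have hhle : ∀ v, ‖h v‖ ≤ |v| ^ (α i - 1) := by
    intro v
    by_cases hv : v ∈ B
    · rw [hh, indicator_of_mem hv, div_neg, norm_neg]
      exact abs_truncPow_div_le (hα i) (gapSign_eq j i)
    · rw [hh, indicator_of_notMem hv, norm_zero]; exact Real.rpow_nonneg (abs_nonneg _) _
  have hpow : IntegrableOn (fun v : ℝ => |v| ^ (α i - 1)) B := by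
    have := integrableOn_abs_sub_rpow (r := α i - 1) (by linarith [hα i]) 0 (R + 1)
    simp_rw [sub_zero] at this
    exact this
  have hint : Integrable h := integrable_of_integrableOn_Icc
    (Integrable.mono' hpow hmeas.restrict (ae_of_all _ hhle)) hsupp
  have hint' : ∀ k ∈ E, Integrable fun v => h v * |v - (y k t - y i t)| ^ (α k - 1) := by
    intro k hk
    have hne : 0 < |y k t - y i t| :=
      abs_pos.2 (sub_ne_zero.2 (hinj k (Finset.ne_of_mem_erase hk)))
    set z := y k t - y i t with hz
    have hzR : |z| ≤ R := hR k
    refine integrable_of_integrableOn_Icc (R := R + 1) ?_ fun u hu => by rw [hsupp u hu, zero_mul]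
    refine Integrable.mono' (((((integrableOn_abs_sub_rpow (r := α k - 1) (by linarith [hα k]) z
      (R + 1))).const_mul ((2 * (R + 1)) ^ α i)).add
      (hpow.const_mul ((2 * (R + 1)) ^ α k))).const_mul |z|⁻¹) ?_ ?_
    · exact (hmeas.mul ((measurable_id.sub_const z).abs.pow_const _).aestronglyMeasurable).restrict
    · filter_upwards [ae_restrict_mem measurableSet_Icc] with v hv
      have hv' := abs_le.2 hv
      have h1 : |v - z| ≤ 2 * (R + 1) := (abs_sub _ _).trans (by linarith)
      rw [inv_mul_eq_div, le_div_iff₀' hne, norm_mul, Real.norm_of_nonneg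
        (Real.rpow_nonneg (abs_nonneg (v - z)) (α k - 1))]
      refine le_trans ?_ (abs_rpow_mul_abs_sub_rpow_le (hα i) (hα k)
        (by linarith : |v| ≤ 2 * (R + 1)) h1)
      have := Real.rpow_nonneg (abs_nonneg (v - z)) (α k - 1)
      gcongr
      exact hhle v
  have key := hasDerivAt_integral_prod_truncPow E hα (gapSign_eq j)
    (y := fun k s => y k s - y i s) (fun k _ => (hy k).sub (hy i)) hsupp hint hint'
  refine (key.congr_deriv ?_).congr_of_eventuallyEq ?_
  · refine Finset.sum_congr rfl fun k hk => ?_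
    have hne : y i t - y k t ≠ 0 := sub_ne_zero.2 (hinj k (Finset.ne_of_mem_erase hk)).symm
    have e : ∀ v, h v * ((∏ l ∈ E, truncPow (α l) (gapSign j l) (v - (y l t - y i t))) /
        (v - (y k t - y i t))) = (fun u => (y i t - y k t)⁻¹ *
          (gapProd α (fun k => y k t) j u / (y i t - u) -
            gapProd α (fun k => y k t) j u / (y k t - u))) (v + y i t) := by
      intro v
      rw [← mul_div_assoc, hh1 t hRs.self_of_nhds v]
      set u := v + y i t with hu
      have hv : v - (y k t - y i t) = u - y k t := by rw [hu]; ring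
      rw [hv]
      simp only
      rcases eq_or_ne u (y i t) with h1 | h1
      · rw [h1, gapProd_node (x := fun k => y k t) hα j i]; simp
      rcases eq_or_ne u (y k t) with h2 | h2
      · rw [h2, gapProd_node (x := fun k => y k t) hα j k]; simp
      have h1' : y i t - u ≠ 0 := sub_ne_zero.2 h1.symm
      have h2' : y k t - u ≠ 0 := sub_ne_zero.2 h2.symm
      have h3' : u - y k t ≠ 0 := sub_ne_zero.2 h2
      field_simp
      ring
    have hi : ∀ k, Integrable fun u => gapProd α (fun k => y k t) j u / (y k t - u) := fun k => by
      simpa using integrable_mul_gapProd_div (F := fun _ => 1) (x := fun k => y k t) hα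
        continuous_const j k
    simp_rw [e]
    rw [integral_add_right_eq_self (fun u => (y i t - y k t)⁻¹ *
          (gapProd α (fun k => y k t) j u / (y i t - u) -
            gapProd α (fun k => y k t) j u / (y k t - u))), integral_const_mul,
      integral_sub (hi i) (hi k)]
    ring
  · filter_upwards [hRs] with s hs
    simp_rw [hh1 s hs]
    exact (integral_add_right_eq_self (fun u => gapProd α (fun k => y k s) j u / (y i s - u))
      (y i s)).symm

end gap

/-! ### The residue system: algebraic identities -/

section residues

variable {ι : Type*} [Fintype ι] [DecidableEq ι] {x x' θ ω ω₁ E B : ι → ℝ} {b : ℝ}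

lemma sum_erase_sub_mul (x' θ : ι → ℝ) (j : ι) :
    ∑ k ∈ Finset.univ.erase j, (x' j - x' k) * θ k = x' j * ∑ k, θ k - ∑ k, x' k * θ k := by
  rw [Finset.sum_erase _ (by simp)]
  simp_rw [sub_mul, Finset.sum_sub_distrib, Finset.mul_sum]

lemma div_sub_mul_sub (hx : Function.Injective x) {j k : ι} (hk : k ∈ Finset.univ.erase j) :
    (x' j - x' k) / (x j - x k) * (x j - x k) = x' j - x' k :=
  div_mul_cancel₀ _ (sub_ne_zero.2 fun h => (Finset.ne_of_mem_erase hk) (hx h).symm)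

/-- The two forms of the equation for `θ`, in terms of `ω` and of `ω₁ = (x - b) θ - ω`, agree. -/
lemma residue_theta_symm (hx : Function.Injective x) (hθ : ∑ k, θ k = 0)
    (h1 : ∀ k, ω₁ k = (x k - b) * θ k - ω k) (j : ι) :
    ∑ k ∈ Finset.univ.erase j, (x' j - x' k) / (x j - x k) * (θ k * ω₁ j - θ j * ω₁ k) +
      ∑ k ∈ Finset.univ.erase j, (x' j - x' k) / (x j - x k) * (θ k * ω j - θ j * ω k) =
    -θ j * ∑ k, x' k * θ k := by
  have h := sum_erase_sub_mul x' θ j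
  rw [hθ, mul_zero, zero_sub] at h
  rw [← Finset.sum_add_distrib, neg_mul, ← mul_neg, ← h, Finset.mul_sum]
  refine Finset.sum_congr rfl fun k hk => ?_
  rw [h1, h1]
  linear_combination θ j * θ k * div_sub_mul_sub (x' := x') hx hk

/-- Propagation of the equation for `ω`; here `E = a_n² θ_{n-1}` and `B = a_{n+1}² θ_{n+1}`. -/
lemma residue_omega_step (hx : Function.Injective x) (hθ : ∑ k, θ k = 0)
    (hω : ∑ k, (ω₁ k - ω k) = 1)
    (h1 : ∀ k, ω₁ k = (x k - b) * θ k - ω k)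
    (h2 : ∀ k, (x k - b) * (ω₁ k - ω k) = B k - E k) (j : ι) :
    (x' j - ∑ k, x' k * (ω₁ k - ω k)) * θ j + (x j - b) *
        (-(∑ k, x' k * θ k) * θ j - 2 * ∑ k ∈ Finset.univ.erase j,
          (x' j - x' k) / (x j - x k) * (θ k * ω j - θ j * ω k)) -
        ∑ k ∈ Finset.univ.erase j, (x' j - x' k) / (x j - x k) * (θ j * E k - θ k * E j) =
      ∑ k ∈ Finset.univ.erase j, (x' j - x' k) / (x j - x k) * (B j * θ k - B k * θ j) := by
  have h := sum_erase_sub_mul x' (fun k => ω₁ k - ω k) j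
  have h' := sum_erase_sub_mul x' θ j
  rw [hω, mul_one] at h
  rw [hθ, mul_zero, zero_sub] at h'
  rw [← h, ← h', ← sub_eq_zero]
  simp only [Finset.mul_sum, Finset.sum_mul, ← Finset.sum_sub_distrib, ← Finset.sum_add_distrib]
  refine Finset.sum_eq_zero fun k hk => ?_
  have hB : ∀ k, B k = (x k - b) * (ω₁ k - ω k) + E k := fun k => by rw [h2]; ring
  rw [hB, hB, h1, h1]
  linear_combination (-((x k - b) * θ k - ω k - ω k) * θ j - (x j - b) * θ j * θ k) *
    div_sub_mul_sub (x' := x') hx hk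

/-- Propagation of the equation for `θ`, in terms of `B = a_{n+1}² θ_{n+1}`. -/
lemma residue_theta_step (hx : Function.Injective x) (hθ : ∑ k, θ k = 0)
    (hω : ∑ k, (ω₁ k - ω k) = 1)
    (h1 : ∀ k, ω₁ k = (x k - b) * θ k - ω k)
    (h2 : ∀ k, (x k - b) * (ω₁ k - ω k) = B k - E k) (j : ι) :
    (x' j - ∑ k, x' k * (ω₁ k - ω k)) * (ω₁ j - ω j) + (x j - b) *
        (∑ k ∈ Finset.univ.erase j, (x' j - x' k) / (x j - x k) * (B j * θ k - B k * θ j) -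
          ∑ k ∈ Finset.univ.erase j, (x' j - x' k) / (x j - x k) * (θ j * E k - θ k * E j)) +
        ((∑ k, x' k * θ k) * E j + 2 * ∑ k ∈ Finset.univ.erase j,
          (x' j - x' k) / (x j - x k) * (E k * ω j - E j * ω k)) =
      -(∑ k, x' k * θ k) * B j - 2 * ∑ k ∈ Finset.univ.erase j,
          (x' j - x' k) / (x j - x k) * (B k * ω₁ j - B j * ω₁ k) := by
  have h := sum_erase_sub_mul x' (fun k => ω₁ k - ω k) j
  have h' := sum_erase_sub_mul x' θ j
  rw [hω, mul_one] at h
  rw [hθ, mul_zero, zero_sub] at h'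
  rw [← h, ← neg_eq_iff_eq_neg.2 h', ← sub_eq_zero]
  simp only [Finset.mul_sum, Finset.sum_mul, ← Finset.sum_neg_distrib,
    ← Finset.sum_sub_distrib, ← Finset.sum_add_distrib]
  refine Finset.sum_eq_zero fun k hk => ?_
  have hB : ∀ k, B k = (x k - b) * (ω₁ k - ω k) + E k := fun k => by rw [h2]; ring
  rw [hB, hB, h1, h1]
  linear_combination (θ k * ((x j - b) * ((x j - b) * θ j - 2 * ω j) + 2 * E j) -
    ((x k - b) * θ k - 2 * ω k) * ((x j - b) * θ j - 2 * ω j)) *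
    div_sub_mul_sub (x' := x') hx hk

/-- The differential system for residues `θ n k`, `ω n k` at the points `x k`, derived by induction
on `n` from the two recurrences, the derivatives of the recurrence coefficients and the case
`n = 0`. -/
theorem hasDerivAt_residues {x : ι → ℝ → ℝ} {x' : ι → ℝ} {t : ℝ}
    (hx' : ∀ k, HasDerivAt (x k) (x' k) t) (hx : Function.Injective fun k => x k t)
    {θ ω : ℕ → ι → ℝ → ℝ} {a b : ℕ → ℝ → ℝ} (ha0 : ∀ s, a 0 s = 0) (hapos : ∀ n, a (n + 1) t ≠ 0)
    (h1 : ∀ᶠ s in 𝓝 t, ∀ n k, ω (n + 1) k s = (x k s - b n s) * θ n k s - ω n k s)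
    (h2 : ∀ᶠ s in 𝓝 t, ∀ n k, (x k s - b n s) * (ω (n + 1) k s - ω n k s) =
      a (n + 1) s ^ 2 * θ (n + 1) k s - a n s ^ 2 * θ (n - 1) k s)
    (hθ : ∀ n, ∑ k, θ n k t = 0) (hω : ∀ n, ∑ k, (ω (n + 1) k t - ω n k t) = 1)
    (ha' : ∀ n, HasDerivAt (a (n + 1))
      (a (n + 1) t * (1 / 2 * (∑ k, x' k * θ (n + 1) k t - ∑ k, x' k * θ n k t))) t)
    (hb' : ∀ n, HasDerivAt (b n) (∑ k, x' k * (ω (n + 1) k t - ω n k t)) t)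
    (hθ0 : ∀ j, HasDerivAt (θ 0 j) (-(∑ k, x' k * θ 0 k t) * θ 0 j t -
      2 * ∑ k ∈ Finset.univ.erase j, (x' j - x' k) / (x j t - x k t) *
        (θ 0 k t * ω 0 j t - θ 0 j t * ω 0 k t)) t)
    (hω0 : ∀ j, HasDerivAt (ω 0 j) 0 t) (n : ℕ) :
    (∀ j, HasDerivAt (θ n j) (-(∑ k, x' k * θ n k t) * θ n j t -
      2 * ∑ k ∈ Finset.univ.erase j, (x' j - x' k) / (x j t - x k t) *
        (θ n k t * ω n j t - θ n j t * ω n k t)) t) ∧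
    (∀ j, HasDerivAt (θ n j) ((∑ k, x' k * θ n k t) * θ n j t +
      2 * ∑ k ∈ Finset.univ.erase j, (x' j - x' k) / (x j t - x k t) *
        (θ n k t * ω (n + 1) j t - θ n j t * ω (n + 1) k t)) t) ∧
    (∀ j, HasDerivAt (ω n j) (∑ k ∈ Finset.univ.erase j, (x' j - x' k) / (x j t - x k t) *
      (θ n j t * (a n t ^ 2 * θ (n - 1) k t) - θ n k t * (a n t ^ 2 * θ (n - 1) j t))) t) := by
  have h1t := h1.self_of_nhds
  have h2t := h2.self_of_nhds
  -- the two forms of the equation for `θ n`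
  have hsymm : ∀ n j, -(∑ k, x' k * θ n k t) * θ n j t -
      2 * ∑ k ∈ Finset.univ.erase j, (x' j - x' k) / (x j t - x k t) *
        (θ n k t * ω n j t - θ n j t * ω n k t) = (∑ k, x' k * θ n k t) * θ n j t +
      2 * ∑ k ∈ Finset.univ.erase j, (x' j - x' k) / (x j t - x k t) *
        (θ n k t * ω (n + 1) j t - θ n j t * ω (n + 1) k t) := fun n j => by
    linear_combination -2 * residue_theta_symm (x := fun k => x k t) (x' := x')
      (θ := fun k => θ n k t) (ω := fun k => ω n k t) (ω₁ := fun k => ω (n + 1) k t) (b := b n t)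
      hx (hθ n) (h1t n) j
  suffices h : (∀ j, HasDerivAt (θ n j) (-(∑ k, x' k * θ n k t) * θ n j t -
      2 * ∑ k ∈ Finset.univ.erase j, (x' j - x' k) / (x j t - x k t) *
        (θ n k t * ω n j t - θ n j t * ω n k t)) t) ∧
    (∀ j, HasDerivAt (ω n j) (∑ k ∈ Finset.univ.erase j, (x' j - x' k) / (x j t - x k t) *
      (θ n j t * (a n t ^ 2 * θ (n - 1) k t) - θ n k t * (a n t ^ 2 * θ (n - 1) j t))) t) ∧
    (∀ j, HasDerivAt (fun s => a n s ^ 2 * θ (n - 1) j s)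
      ((∑ k, x' k * θ n k t) * (a n t ^ 2 * θ (n - 1) j t) +
        2 * ∑ k ∈ Finset.univ.erase j, (x' j - x' k) / (x j t - x k t) *
          ((a n t ^ 2 * θ (n - 1) k t) * ω n j t - (a n t ^ 2 * θ (n - 1) j t) * ω n k t)) t) from
    ⟨h.1, fun j => (h.1 j).congr_deriv (hsymm n j), h.2.1⟩
  induction n with
  | zero =>
    refine ⟨hθ0, fun j => (hω0 j).congr_deriv ?_, fun j => ?_⟩
    · simp [ha0]
    · simpa [ha0] using hasDerivAt_const t (0 : ℝ)
  | succ n ih =>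
    obtain ⟨iθ, iω, iE⟩ := ih
    have hω1 : ∀ j, HasDerivAt (ω (n + 1) j)
        (∑ k ∈ Finset.univ.erase j, (x' j - x' k) / (x j t - x k t) *
          ((a (n + 1) t ^ 2 * θ (n + 1) j t) * θ n k t -
            (a (n + 1) t ^ 2 * θ (n + 1) k t) * θ n j t)) t := by
      intro j
      refine ((((hx' j).sub (hb' n)).mul (iθ j)).sub (iω j)).congr_deriv ?_ |>.congr_of_eventuallyEq
        (h1.mono fun s hs => hs n j)
      exact residue_omega_step (x := fun k => x k t) (x' := x')
        (θ := fun k => θ n k t) (ω := fun k => ω n k t) (ω₁ := fun k => ω (n + 1) k t) (b := b n t)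
        (E := fun k => a n t ^ 2 * θ (n - 1) k t) (B := fun k => a (n + 1) t ^ 2 * θ (n + 1) k t)
        hx (hθ n) (hω n) (h1t n) (h2t n) j
    have hB : ∀ j, HasDerivAt (fun s => a (n + 1) s ^ 2 * θ (n + 1) j s)
        (-(∑ k, x' k * θ n k t) * (a (n + 1) t ^ 2 * θ (n + 1) j t) -
          2 * ∑ k ∈ Finset.univ.erase j, (x' j - x' k) / (x j t - x k t) *
            ((a (n + 1) t ^ 2 * θ (n + 1) k t) * ω (n + 1) j t -
              (a (n + 1) t ^ 2 * θ (n + 1) j t) * ω (n + 1) k t)) t := by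
      intro j
      refine ((((hx' j).sub (hb' n)).mul ((hω1 j).sub (iω j))).add (iE j)).congr_deriv ?_
        |>.congr_of_eventuallyEq (h2.mono fun s hs => ?_)
      · exact residue_theta_step (x := fun k => x k t) (x' := x')
          (θ := fun k => θ n k t) (ω := fun k => ω n k t) (ω₁ := fun k => ω (n + 1) k t)
          (b := b n t) (E := fun k => a n t ^ 2 * θ (n - 1) k t)
          (B := fun k => a (n + 1) t ^ 2 * θ (n + 1) k t)
          hx (hθ n) (hω n) (h1t n) (h2t n) j
      · have := hs n j
        simp only [Pi.add_apply, Pi.mul_apply, Pi.sub_apply]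
        linear_combination -this
    refine ⟨fun j => ?_, fun j => (hω1 j).congr_deriv ?_, fun j => ?_⟩
    · have ha2 : a (n + 1) t ^ 2 ≠ 0 := pow_ne_zero 2 (hapos n)
      have hane : ∀ᶠ s in 𝓝 t, a (n + 1) s ≠ 0 := (ha' n).continuousAt.eventually_ne (hapos n)
      refine ((hB j).div ((ha' n).pow 2) ha2).congr_deriv ?_ |>.congr_of_eventuallyEq
        (hane.mono fun s hs => ?_)
      · have e : ∑ k ∈ Finset.univ.erase j, (x' j - x' k) / (x j t - x k t) *
            ((a (n + 1) t ^ 2 * θ (n + 1) k t) * ω (n + 1) j t -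
              (a (n + 1) t ^ 2 * θ (n + 1) j t) * ω (n + 1) k t) =
            a (n + 1) t ^ 2 * ∑ k ∈ Finset.univ.erase j, (x' j - x' k) / (x j t - x k t) *
              (θ (n + 1) k t * ω (n + 1) j t - θ (n + 1) j t * ω (n + 1) k t) := by
          rw [Finset.mul_sum]; exact Finset.sum_congr rfl fun k _ => by ring
        have h0 := hapos n
        rw [e]
        generalize ∑ k ∈ Finset.univ.erase j, (x' j - x' k) / (x j t - x k t) *
          (θ (n + 1) k t * ω (n + 1) j t - θ (n + 1) j t * ω (n + 1) k t) = Z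
        simp only [Pi.pow_apply]
        field_simp
        push_cast
        ring
      · simp only [Pi.div_apply, Pi.pow_apply]
        rw [mul_div_cancel_left₀ _ (pow_ne_zero 2 hs)]
    · exact Finset.sum_congr rfl fun k _ => by rw [Nat.add_sub_cancel]; ring
    · rw [Nat.add_sub_cancel]
      refine (((ha' n).pow 2).mul (iθ j)).congr_deriv ?_
      have e : ∑ k ∈ Finset.univ.erase j, (x' j - x' k) / (x j t - x k t) *
          ((a (n + 1) t ^ 2 * θ n k t) * ω (n + 1) j t -
            (a (n + 1) t ^ 2 * θ n j t) * ω (n + 1) k t) =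
          a (n + 1) t ^ 2 * ∑ k ∈ Finset.univ.erase j, (x' j - x' k) / (x j t - x k t) *
            (θ n k t * ω (n + 1) j t - θ n j t * ω (n + 1) k t) := by
        rw [Finset.mul_sum]; exact Finset.sum_congr rfl fun k _ => by ring
      rw [e, hsymm]
      simp only [Pi.pow_apply]
      push_cast
      ring

end residues

/-! ### Orthonormal polynomials for a linear functional -/

/-- `p n` has degree `n`, positive leading coefficient, and `L (p i * p j) = δ_ij`. -/
structure IsOrthonormal (L : ℝ[X] →ₗ[ℝ] ℝ) (p : ℕ → ℝ[X]) : Prop where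
  natDegree_eq : ∀ n, (p n).natDegree = n
  leadingCoeff_pos : ∀ n, 0 < (p n).leadingCoeff
  map_mul : ∀ i j, L (p i * p j) = if i = j then 1 else 0

lemma map_C_mul (L : ℝ[X] →ₗ[ℝ] ℝ) (r : ℝ) (q : ℝ[X]) : L (C r * q) = r * L q := by
  rw [← smul_eq_C_mul, map_smul, smul_eq_mul]

namespace IsOrthonormal

variable {L : ℝ[X] →ₗ[ℝ] ℝ} {p : ℕ → ℝ[X]} (h : IsOrthonormal L p)

include h

lemma map_self (n : ℕ) : L (p n * p n) = 1 := by rw [h.map_mul, if_pos rfl]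

lemma coeff_self (n : ℕ) : (p n).coeff n = (p n).leadingCoeff := by
  rw [leadingCoeff, h.natDegree_eq]

lemma map_mul_of_natDegree_le {n : ℕ} {f : ℝ[X]} (hf : f.natDegree ≤ n) :
    L (f * p n) = f.coeff n / (p n).leadingCoeff := by
  suffices H : ∀ d ≤ n + 1, ∀ f : ℝ[X], f.degree < d →
      L (f * p n) = f.coeff n / (p n).leadingCoeff from
    H (n + 1) le_rfl f (degree_lt_iff_coeff_zero _ _ |>.2 fun m hm =>
      coeff_eq_zero_of_natDegree_lt (by omega))
  intro d
  induction d with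
  | zero =>
    intro _ f hf
    have : f = 0 := by simpa using hf
    simp [this]
  | succ d ih =>
    intro hd f hf
    have hl := (h.leadingCoeff_pos d).ne'
    set r := f.coeff d / (p d).leadingCoeff with hr
    have hg : (f - C r * p d).degree < d := by
      rw [degree_lt_iff_coeff_zero] at hf ⊢
      intro m hm
      rw [coeff_sub, coeff_C_mul]
      rcases hm.eq_or_lt with rfl | hm
      · rw [h.coeff_self, hr, div_mul_cancel₀ _ hl, sub_self]
      · rw [hf m hm, coeff_eq_zero_of_natDegree_lt (by rw [h.natDegree_eq]; exact hm), mul_zero,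
          sub_zero]
    have e := ih (by omega) _ hg
    rw [sub_mul, map_sub, mul_assoc, map_C_mul, h.map_mul, coeff_sub, coeff_C_mul] at e
    rcases eq_or_ne d n with rfl | hdn
    · rw [if_pos rfl, h.coeff_self, hr, div_mul_cancel₀ _ hl, sub_self, zero_div] at e
      linarith
    · rw [if_neg hdn, coeff_eq_zero_of_natDegree_lt (p := p d) (by rw [h.natDegree_eq]; omega)] at e
      simpa using e

lemma map_mul_of_natDegree_lt {n : ℕ} {f : ℝ[X]} (hf : f.natDegree < n) : L (f * p n) = 0 := by
  rw [h.map_mul_of_natDegree_le hf.le, coeff_eq_zero_of_natDegree_lt hf, zero_div]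

lemma eq_zero_of_map_mul {N : ℕ} {f : ℝ[X]} (hf : f.natDegree ≤ N)
    (h0 : ∀ k ≤ N, L (f * p k) = 0) : f = 0 := by
  have := h0 _ hf
  rw [h.map_mul_of_natDegree_le le_rfl, div_eq_zero_iff] at this
  exact leadingCoeff_eq_zero.1 (this.resolve_right (h.leadingCoeff_pos _).ne')

lemma map_X_mul_succ (n : ℕ) :
    L (X * p n * p (n + 1)) = (p n).leadingCoeff / (p (n + 1)).leadingCoeff := by
  rw [h.map_mul_of_natDegree_le, coeff_X_mul, h.coeff_self]
  exact natDegree_mul_le.trans (by rw [h.natDegree_eq, natDegree_X, add_comm])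

theorem isThreeTerm {a b : ℕ → ℝ} (ha0 : a 0 = 0) (ha : ∀ n, a (n + 1) = L (X * p n * p (n + 1)))
    (hb : ∀ n, b n = L (X * p n * p n)) : IsThreeTerm p a b where
  zero := ha0
  pos n := by
    rw [ha, h.map_X_mul_succ]; exact div_pos (h.leadingCoeff_pos _) (h.leadingCoeff_pos _)
  recurrence n := by
    have hle : ∀ m, m ≤ n + 1 → (p m).natDegree ≤ n + 1 := fun m hm => by rwa [h.natDegree_eq]
    have hX : ∀ m, (X * p m).natDegree ≤ m + 1 := fun m =>
      natDegree_mul_le.trans (by rw [h.natDegree_eq, natDegree_X, add_comm])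
    have h0 : X * p n - C (a (n + 1)) * p (n + 1) - C (b n) * p n - C (a n) * p (n - 1) = 0 := by
      refine h.eq_zero_of_map_mul (N := n + 1) ?_ fun k hk => ?_
      · refine (natDegree_sub_le_of_le (natDegree_sub_le_of_le (natDegree_sub_le_of_le (hX n)
          ((natDegree_C_mul_le _ _).trans (hle _ le_rfl)))
          ((natDegree_C_mul_le _ _).trans (hle _ (by omega))))
          ((natDegree_C_mul_le _ _).trans (hle _ (by omega)))).trans (by simp)
      · simp only [sub_mul, map_sub, mul_assoc, map_C_mul, h.map_mul]
        rw [← mul_assoc]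
        rcases eq_or_ne k (n + 1) with rfl | h1
        · rw [if_pos rfl, if_neg (by omega), if_neg (by omega), ha]; ring
        rcases eq_or_ne k n with rfl | h2
        · rw [if_neg (by omega), if_pos rfl, hb]
          rcases k with _ | k
          · simp [ha0]
          · rw [if_neg (by omega)]; ring
        rw [if_neg (by omega), if_neg (by omega)]
        rcases n with _ | n
        · omega
        rw [Nat.add_sub_cancel]
        rw [mul_right_comm, mul_comm]
        rcases eq_or_ne k n with rfl | h3
        · rw [if_pos rfl, ha k, mul_comm (p (k + 1))]; ring
        · rw [if_neg (by omega), mul_comm, h.map_mul_of_natDegree_lt ((hX k).trans_lt (by omega))]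
          ring
    linear_combination -h0

end IsOrthonormal

/-! ### Structure polynomials from residues -/

/-- The polynomial `∑ k, v k * W / (X - x k)`, where `W` is the nodal polynomial: up to the factor
`W' (x k)` it interpolates the values `v k`, and `v k` are the residues of its quotient by `W`. -/
noncomputable def residuePoly {M : ℕ} (x v : Fin (M + 1) → ℝ) : ℝ[X] :=
  ∑ k, C (v k) * ∏ i ∈ Finset.univ.erase k, (X - C (x i))

section residuePoly

variable {M : ℕ} {x : Fin (M + 1) → ℝ}

lemma residuePoly_sub (v v' : Fin (M + 1) → ℝ) :
    residuePoly x (fun k => v k - v' k) = residuePoly x v - residuePoly x v' := by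
  simp [residuePoly, sub_mul, Finset.sum_sub_distrib]

lemma residuePoly_mul (r : ℝ) (v : Fin (M + 1) → ℝ) :
    residuePoly x (fun k => r * v k) = C r * residuePoly x v := by
  simp [residuePoly, Finset.mul_sum, mul_assoc]

lemma logDerivNum_eq (α : Fin (M + 1) → ℝ) :
    logDerivNum α x = residuePoly x fun k => α k / 2 := by
  simp_rw [div_eq_inv_mul, residuePoly_mul]
  rw [logDerivNum, residuePoly, one_div]

lemma X_sub_C_mul_residuePoly (b : ℝ) (v : Fin (M + 1) → ℝ) :
    (X - C b) * residuePoly x v =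
      residuePoly x (fun k => (x k - b) * v k) + C (∑ k, v k) * nodal x := by
  simp only [residuePoly, Finset.mul_sum, map_sum, Finset.sum_mul, ← Finset.sum_add_distrib]
  refine Finset.sum_congr rfl fun k _ => ?_
  rw [nodal, ← Finset.mul_prod_erase _ _ (Finset.mem_univ k), C_mul, C_sub]
  ring

lemma natDegree_prod_erase (k : Fin (M + 1)) :
    (∏ i ∈ Finset.univ.erase k, (X - C (x i))).natDegree = M := by
  rw [natDegree_prod_of_monic _ _ fun i _ => monic_X_sub_C _]
  simp

lemma natDegree_residuePoly_le (v : Fin (M + 1) → ℝ) : (residuePoly x v).natDegree ≤ M :=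
  natDegree_sum_le_of_forall_le _ _ fun k _ =>
    (natDegree_C_mul_le _ _).trans (natDegree_prod_erase k).le

lemma coeff_residuePoly (v : Fin (M + 1) → ℝ) : (residuePoly x v).coeff M = ∑ k, v k := by
  rw [residuePoly, finsetSum_coeff]
  refine Finset.sum_congr rfl fun k _ => ?_
  have h := (monic_prod_of_monic (Finset.univ.erase k) (fun i => X - C (x i))
    fun i _ => monic_X_sub_C _).coeff_natDegree
  rw [natDegree_prod_erase] at h
  rw [coeff_C_mul, h, mul_one]

lemma derivative_nodal : derivative (nodal x) = residuePoly x fun _ => 1 := by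
  rw [nodal, derivative_prod_finset, residuePoly]
  simp

lemma eval_residuePoly_eq_prod (v : Fin (M + 1) → ℝ) (j : Fin (M + 1)) :
    (residuePoly x v).eval (x j) = v j * ∏ i ∈ Finset.univ.erase j, (x j - x i) := by
  rw [residuePoly, eval_finsetSum, Finset.sum_eq_single j]
  · simp [eval_prod]
  · intro k _ hk
    rw [eval_mul, eval_prod, Finset.prod_eq_zero (i := j) (by simp [hk.symm]) (by simp), mul_zero]
  · simp

lemma eval_residuePoly (v : Fin (M + 1) → ℝ) (j : Fin (M + 1)) :
    (residuePoly x v).eval (x j) = v j * nodalDeriv x j := by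
  rw [nodalDeriv, derivative_nodal, eval_residuePoly_eq_prod, eval_residuePoly_eq_prod, one_mul]

lemma nodalDeriv_ne_zero (hx : Function.Injective x) (j : Fin (M + 1)) : nodalDeriv x j ≠ 0 := by
  rw [nodalDeriv, derivative_nodal, eval_residuePoly_eq_prod, one_mul, Finset.prod_ne_zero_iff]
  exact fun i hi => sub_ne_zero.2 fun h => Finset.ne_of_mem_erase hi (hx h).symm

end residuePoly

/-- The residue `Θ_n (x k) / W' (x k)`, for the functional `T k q = α k ∫ q w / (x k - u)`. -/
noncomputable def resTheta {ι : Type*} (T : ι → ℝ[X] →ₗ[ℝ] ℝ) (p : ℕ → ℝ[X]) (n : ℕ) (k : ι) : ℝ :=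
  T k (p n * p n)

/-- The residue `Ω_n (x k) / W' (x k)`, for the functional `T k q = α k ∫ q w / (x k - u)`. -/
noncomputable def resOmega {ι : Type*} (α : ι → ℝ) (T : ι → ℝ[X] →ₗ[ℝ] ℝ) (p : ℕ → ℝ[X])
    (a : ℕ → ℝ) (n : ℕ) (k : ι) : ℝ :=
  α k / 2 + a n * T k (p n * p (n - 1))

section structurePolys

variable {M : ℕ} {x α : Fin (M + 1) → ℝ} {L : ℝ[X] →ₗ[ℝ] ℝ} {T : Fin (M + 1) → ℝ[X] →ₗ[ℝ] ℝ}
  {p : ℕ → ℝ[X]} {a b : ℕ → ℝ}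

lemma map_three_term (hp : IsOrthonormal L p) (hab : IsThreeTerm p a b)
    (hT : ∀ k q, T k ((C (x k) - X) * q) = α k * L q) (n m : ℕ) (k : Fin (M + 1)) :
    (x k - b n) * T k (p n * p m) = α k * (if n = m then 1 else 0) +
      a (n + 1) * T k (p (n + 1) * p m) + a n * T k (p (n - 1) * p m) := by
  have e : C (x k - b n) * (p n * p m) = (C (x k) - X) * (p n * p m) +
      C (a (n + 1)) * (p (n + 1) * p m) + C (a n) * (p (n - 1) * p m) := by
    have := hab.recurrence n
    rw [C_sub]
    linear_combination -p m * this
  rw [← map_C_mul, e, map_add, map_add, hT, map_C_mul, map_C_mul, hp.map_mul]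

lemma resOmega_succ (hp : IsOrthonormal L p) (hab : IsThreeTerm p a b)
    (hT : ∀ k q, T k ((C (x k) - X) * q) = α k * L q) (n : ℕ) (k : Fin (M + 1)) :
    resOmega α T p a (n + 1) k = (x k - b n) * resTheta T p n k - resOmega α T p a n k := by
  have h := map_three_term hp hab hT n n k
  rw [if_pos rfl] at h
  rw [resTheta, h, resOmega, resOmega, Nat.add_sub_cancel, mul_comm (p (n - 1))]
  ring

lemma resTheta_succ (hp : IsOrthonormal L p) (hab : IsThreeTerm p a b)
    (hT : ∀ k q, T k ((C (x k) - X) * q) = α k * L q) (n : ℕ) (k : Fin (M + 1)) :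
    (x k - b n) * (resOmega α T p a (n + 1) k - resOmega α T p a n k) =
      a (n + 1) ^ 2 * resTheta T p (n + 1) k - a n ^ 2 * resTheta T p (n - 1) k := by
  have h1 := map_three_term hp hab hT n (n + 1) k
  have h2 : a n * ((x k - b n) * T k (p n * p (n - 1))) =
      a n * (a (n + 1) * T k (p (n + 1) * p (n - 1)) + a n * T k (p (n - 1) * p (n - 1))) := by
    rcases n with _ | n
    · simp [hab.zero]
    · rw [map_three_term hp hab hT (n + 1) (n + 1 - 1) k, if_neg (by omega)]; ring
  rw [if_neg (by omega)] at h1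
  rw [resOmega, resOmega, resTheta, resTheta, Nat.add_sub_cancel, mul_comm (p (n + 1)) (p n)]
  rw [mul_comm (p (n - 1)) (p (n + 1))] at h1
  linear_combination a (n + 1) * h1 - h2

lemma map_derivative_mul_self (hp : IsOrthonormal L p) (n : ℕ) :
    L (derivative (p n) * p n) = 0 := by
  rcases n with _ | n
  · rw [natDegree_eq_zero.1 (hp.natDegree_eq 0) |>.choose_spec.symm]; simp
  · exact hp.map_mul_of_natDegree_lt ((natDegree_derivative_lt (by simp [hp.natDegree_eq])).trans_le
      (hp.natDegree_eq _).le)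

lemma map_derivative_mul_of_lt (hp : IsOrthonormal L p) {m n : ℕ} (h : m < n) :
    L (derivative (p m) * p n) = 0 :=
  hp.map_mul_of_natDegree_lt ((natDegree_derivative_le _).trans_lt (by rw [hp.natDegree_eq]; omega))

lemma sum_resTheta (hp : IsOrthonormal L p) (hsum : ∀ q, ∑ k, T k q = L (derivative q)) (n : ℕ) :
    ∑ k, resTheta T p n k = 0 := by
  simp_rw [resTheta]
  rw [hsum, derivative_mul, map_add, mul_comm (p n), map_derivative_mul_self hp, add_zero]

/-- `a_n L (p_n' p_{n-1})` increases by one at each step; it is the sum of the residues of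
`Ω_n - V`. -/
lemma sum_resOmega_succ_sub (hp : IsOrthonormal L p) (hab : IsThreeTerm p a b)
    (hsum : ∀ q, ∑ k, T k q = L (derivative q)) (n : ℕ) :
    ∑ k, (resOmega α T p a (n + 1) k - resOmega α T p a n k) = 1 := by
  simp_rw [resOmega, add_sub_add_left_eq_sub]
  rw [Finset.sum_sub_distrib, ← Finset.mul_sum, ← Finset.mul_sum, hsum, hsum, Nat.add_sub_cancel,
    derivative_mul, derivative_mul, map_add, map_add, mul_comm (p (n + 1)),
    map_derivative_mul_of_lt hp (Nat.lt_succ_self n), add_zero]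
  have hr := hab.recurrence n
  have hd := congrArg derivative hr
  simp only [derivative_mul, derivative_sub, derivative_C, derivative_X, zero_mul, zero_add,
    sub_zero, one_mul] at hd
  have hpp := hp.map_self n
  have hnn := map_derivative_mul_self hp n
  -- pair the differentiated recurrence with `p n`, and the recurrence with `(p n)'`
  have e1 : C (a (n + 1)) * (derivative (p (n + 1)) * p n) =
      p n * p n + C (a (n + 1)) * (derivative (p n) * p (n + 1)) +
        C (a n) * (derivative (p n) * p (n - 1)) - C (a n) * (derivative (p (n - 1)) * p n) := by
    linear_combination p n * hd - derivative (p n) * hr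
  have h1 := congrArg L e1
  simp only [map_add, map_sub, map_C_mul] at h1
  rw [h1, hpp, map_derivative_mul_of_lt hp (Nat.lt_succ_self n), mul_comm (p n)]
  have h2 : a n * L (derivative (p (n - 1)) * p n) = 0 := by
    rcases n with _ | n
    · rw [hab.zero, zero_mul]
    · rw [map_derivative_mul_of_lt hp (by omega), mul_zero]
  linear_combination -2 * h2

/-- The two recurrences imply the differential relation, by induction on `n`. -/
lemma diff_rel_of_rec {W V : ℝ[X]} {Ω Θ : ℕ → ℝ[X]} (hab : IsThreeTerm p a b)
    (hp0 : derivative (p 0) = 0) (h0 : Ω 0 = V)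
    (hΩ : ∀ n, Ω (n + 1) = (X - C (b n)) * Θ n - Ω n)
    (hΘ : ∀ n, (X - C (b n)) * (Ω (n + 1) - Ω n) =
      W + C (a (n + 1) ^ 2) * Θ (n + 1) - C (a n ^ 2) * Θ (n - 1)) (n : ℕ) :
    W * derivative (p n) = (Ω n - V) * p n - C (a n) * Θ n * p (n - 1) := by
  suffices H : W * derivative (p n) = (Ω n - V) * p n - C (a n) * Θ n * p (n - 1) ∧
      C (a n) * (W * derivative (p (n - 1))) =
        C (a n) * (C (a n) * Θ (n - 1) * p n - (Ω n + V) * p (n - 1)) from H.1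
  induction n with
  | zero => simp [hp0, h0, hab.zero]
  | succ n ih =>
    obtain ⟨ih1, ih2⟩ := ih
    have hr := hab.recurrence n
    have hd := congrArg derivative hr
    simp only [derivative_mul, derivative_sub, derivative_C, derivative_X, zero_mul, zero_add,
      sub_zero, one_mul] at hd
    have ha : C (a (n + 1)) ≠ 0 := C_ne_zero.2 (hab.pos n).ne'
    have h1 := hΩ n
    have h2 := hΘ n
    rw [C_pow, C_pow] at h2
    rw [Nat.add_sub_cancel]
    constructor
    · refine mul_left_cancel₀ ha ?_
      linear_combination W * hd + (X - C (b n)) * ih1 - ih2 -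
        (Ω (n + 1) - V) * hr - p n * h2 + C (a n) * p (n - 1) * h1
    · linear_combination C (a (n + 1)) * (ih1 - Θ n * hr + p n * h1)

/-- Existence of the structure polynomials. That the residues of `Θ n` sum to zero gives the bound
on its degree; that those of `Ω (n + 1) - Ω n` sum to one produces the summand `W`. -/
theorem isLaguerreFreud_residuePoly (hM : 1 ≤ M) (hp : IsOrthonormal L p)
    (hab : IsThreeTerm p a b) (hT : ∀ k q, T k ((C (x k) - X) * q) = α k * L q)
    (hsum : ∀ q, ∑ k, T k q = L (derivative q)) :
    IsLaguerreFreud (M + 1) (nodal x) (logDerivNum α x) p a b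
      (fun n => residuePoly x (resOmega α T p a n)) (fun n => residuePoly x (resTheta T p n)) := by
  have hΩ : ∀ n, residuePoly x (resOmega α T p a (n + 1)) =
      (X - C (b n)) * residuePoly x (resTheta T p n) - residuePoly x (resOmega α T p a n) := by
    intro n
    rw [X_sub_C_mul_residuePoly, sum_resTheta hp hsum, C_0, zero_mul, add_zero, ← residuePoly_sub]
    congr 1
    funext k
    exact resOmega_succ hp hab hT n k
  have hΘ : ∀ n, (X - C (b n)) * (residuePoly x (resOmega α T p a (n + 1)) -
      residuePoly x (resOmega α T p a n)) =
        nodal x + C (a (n + 1) ^ 2) * residuePoly x (resTheta T p (n + 1)) -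
          C (a n ^ 2) * residuePoly x (resTheta T p (n - 1)) := by
    intro n
    rw [← residuePoly_sub, X_sub_C_mul_residuePoly, sum_resOmega_succ_sub hp hab hsum, C_1, one_mul,
      ← residuePoly_mul, ← residuePoly_mul, add_sub_assoc, ← residuePoly_sub, add_comm]
    congr 2
    funext k
    exact resTheta_succ hp hab hT n k
  refine ⟨fun n => ?_, fun n => ?_, ?_, hΩ, hΘ⟩
  · exact degree_le_of_natDegree_le (natDegree_residuePoly_le _)
  · rw [degree_le_iff_coeff_zero]
    intro m hm
    have hm' : M + 1 - 2 < m := by exact_mod_cast hm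
    rcases (show M ≤ m by omega).eq_or_lt with rfl | h
    · rw [coeff_residuePoly, sum_resTheta hp hsum]
    · exact coeff_eq_zero_of_natDegree_lt ((natDegree_residuePoly_le _).trans_lt h)
  · refine diff_rel_of_rec hab ?_ ?_ hΩ hΘ
    · rw [natDegree_eq_zero.1 (hp.natDegree_eq 0) |>.choose_spec.symm, derivative_C]
    · rw [logDerivNum_eq]
      congr 1
      funext k
      simp [resOmega, hab.zero]

/-- Two systems of structure polynomials differ by `D p_n² / p_0²` and `a_n D p_n p_{n-1} / p_0²`
for one polynomial `D`; the bound on the degrees of the `Θ n` forces `D = 0`. -/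
theorem IsLaguerreFreud.unique {m : ℕ} {W V : ℝ[X]} {Ω Θ Ω' Θ' : ℕ → ℝ[X]}
    (hp : IsOrthonormal L p) (hab : IsThreeTerm p a b) (h : IsLaguerreFreud m W V p a b Ω Θ)
    (h' : IsLaguerreFreud m W V p a b Ω' Θ') : Ω = Ω' ∧ Θ = Θ' := by
  have hpne : ∀ n, p n ≠ 0 := fun n => leadingCoeff_ne_zero.1 (hp.leadingCoeff_pos n).ne'
  have hp0 : derivative (p 0) = 0 := by
    rw [natDegree_eq_zero.1 (hp.natDegree_eq 0) |>.choose_spec.symm, derivative_C]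
  have hΩ0 : ∀ {Ω Θ : ℕ → ℝ[X]}, IsLaguerreFreud m W V p a b Ω Θ → Ω 0 = V := by
    intro Ω Θ h
    have := h.diff_rel 0
    rw [hp0, hab.zero, mul_zero, C_0, zero_mul, zero_mul, sub_zero, eq_comm, mul_eq_zero] at this
    exact sub_eq_zero.1 (this.resolve_right (hpne 0))
  set D := Θ 0 - Θ' 0 with hD
  have key : ∀ n, (Θ n - Θ' n) * p 0 ^ 2 = D * p n ^ 2 ∧
      (Ω n - Ω' n) * p 0 ^ 2 = C (a n) * D * p n * p (n - 1) ∧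
      C (a n ^ 2) * (Θ (n - 1) - Θ' (n - 1)) * p 0 ^ 2 = C (a n ^ 2) * D * p (n - 1) ^ 2 := by
    intro n
    induction n with
    | zero => simp [hab.zero, hD, hΩ0 h, hΩ0 h']
    | succ n ih =>
      obtain ⟨i1, i2, i3⟩ := ih
      have hr := hab.recurrence n
      have e2 : (Ω (n + 1) - Ω' (n + 1)) * p 0 ^ 2 = C (a (n + 1)) * D * p (n + 1) * p n := by
        rw [h.rec_Ω, h'.rec_Ω]
        linear_combination (X - C (b n)) * i1 - i2 - D * p n * hr
      refine ⟨?_, e2, ?_⟩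
      · have ha : C (a (n + 1)) ^ 2 ≠ 0 := pow_ne_zero 2 (C_ne_zero.2 (hab.pos n).ne')
        refine mul_left_cancel₀ ha ?_
        have q1 := h.rec_Θ n
        have q2 := h'.rec_Θ n
        rw [C_pow, C_pow] at q1 q2
        rw [C_pow] at i3
        linear_combination p 0 ^ 2 * (q2 - q1) + (X - C (b n)) * (e2 - i2) + i3 -
          D * (C (a (n + 1)) * p (n + 1) - C (a n) * p (n - 1)) * hr
      · rw [Nat.add_sub_cancel]
        linear_combination C (a (n + 1) ^ 2) * i1
  have hp02 : p 0 ^ 2 ≠ 0 := pow_ne_zero 2 (hpne 0)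
  have hD0 : D = 0 := by
    by_contra hne
    have e := congrArg natDegree (key (m + 1)).1
    rw [natDegree_mul hne (pow_ne_zero 2 (hpne _)), natDegree_pow, hp.natDegree_eq] at e
    have hle := (natDegree_mul_le (p := Θ (m + 1) - Θ' (m + 1)) (q := p 0 ^ 2))
    rw [natDegree_pow, hp.natDegree_eq] at hle
    have hd : (Θ (m + 1) - Θ' (m + 1)).natDegree ≤ m - 2 :=
      (natDegree_sub_le_of_le (natDegree_le_of_degree_le (h.degree_Θ _))
        (natDegree_le_of_degree_le (h'.degree_Θ _))).trans (by simp)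
    omega
  constructor
  · funext n
    have := (key n).2.1
    rw [hD0, mul_zero, zero_mul, zero_mul, mul_eq_zero] at this
    exact sub_eq_zero.1 (this.resolve_right hp02)
  · funext n
    have := (key n).1
    rw [hD0, zero_mul, mul_eq_zero] at this
    exact sub_eq_zero.1 (this.resolve_right hp02)

end structurePolys

/-! ### The functionals of the weight -/

open Classical in
/-- The linear functional `q ↦ ∫ q w` on polynomials, and `0` if some of the integrals diverge. -/
noncomputable def integralFunctional (w : ℝ → ℝ) : ℝ[X] →ₗ[ℝ] ℝ :=
  if h : ∀ q : ℝ[X], Integrable fun u => q.eval u * w u then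
    { toFun := fun q => ∫ u, q.eval u * w u
      map_add' := fun f g => by
        simp_rw [eval_add, add_mul]; exact integral_add (h f) (h g)
      map_smul' := fun r f => by
        simp_rw [eval_smul, smul_eq_mul, mul_assoc]; exact integral_const_mul _ _ }
  else 0

lemma integralFunctional_apply {w : ℝ → ℝ} (h : ∀ q : ℝ[X], Integrable fun u => q.eval u * w u)
    (q : ℝ[X]) : integralFunctional w q = ∫ u, q.eval u * w u := by
  rw [integralFunctional, dif_pos h]; rfl

lemma polyInner_eq {w : ℝ → ℝ} (h : ∀ q : ℝ[X], Integrable fun u => q.eval u * w u)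
    (f g : ℝ[X]) : polyInner w f g = integralFunctional w (f * g) := by
  rw [integralFunctional_apply h, polyInner]; simp_rw [eval_mul]

section functionals

variable {M : ℕ} {α x : Fin (M + 1) → ℝ} (hα : ∀ k, 0 < α k) {c : Fin M → ℝ}

/-- The functional `q ↦ α k ∫ q w / (x k - u)`; it is the derivative of `q ↦ ∫ q w`
with respect to the node `x k`, and its values on products of orthonormal polynomials are the
residues of the structure polynomials. -/
noncomputable def nodeFunctional (α : Fin (M + 1) → ℝ) (c : Fin M → ℝ) (x : Fin (M + 1) → ℝ)
    (k : Fin (M + 1)) : ℝ[X] →ₗ[ℝ] ℝ :=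
  α k • integralFunctional fun u => weight α c x u / (x k - u)

include hα

lemma nodeFunctional_apply (hx : StrictMono x) (k : Fin (M + 1)) (q : ℝ[X]) :
    nodeFunctional α c x k q = α k * ∫ u, q.eval u * (weight α c x u / (x k - u)) := by
  rw [nodeFunctional, LinearMap.smul_apply, smul_eq_mul,
    integralFunctional_apply fun q => integrable_mul_weight_div hα q.continuous hx k]

lemma weightFunctional_apply (hx : StrictMono x) (q : ℝ[X]) :
    integralFunctional (weight α c x) q = ∫ u, q.eval u * weight α c x u :=
  integralFunctional_apply (fun q => integrable_mul_weight hα q.continuous hx) q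

lemma nodeFunctional_mul (hx : StrictMono x) (k : Fin (M + 1)) (q : ℝ[X]) :
    nodeFunctional α c x k ((C (x k) - X) * q) =
      α k * integralFunctional (weight α c x) q := by
  rw [nodeFunctional_apply hα hx, weightFunctional_apply hα hx]
  congr 1
  refine integral_congr_ae (ae_of_all _ fun u => ?_)
  simp only [eval_mul, eval_sub, eval_C, eval_X]
  rcases eq_or_ne u (x k) with rfl | hu
  · rw [weight_eq_sum hα hx]; simp [gapProd_node hα]
  · have : x k - u ≠ 0 := sub_ne_zero.2 hu.symm
    field_simp

lemma sum_nodeFunctional (hx : StrictMono x) (q : ℝ[X]) :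
    ∑ k, nodeFunctional α c x k q = integralFunctional (weight α c x) (derivative q) := by
  rw [weightFunctional_apply hα hx, integral_mul_weight hα (derivative q).continuous hx]
  simp_rw [nodeFunctional_apply hα hx, integral_mul_weight_div hα q.continuous hx,
    ← sum_integral_gapProd_div hα q, Finset.mul_sum]
  rw [Finset.sum_comm]
  exact Finset.sum_congr rfl fun _ _ => Finset.sum_congr rfl fun _ _ => by ring

lemma weightFunctional_mul_self_pos (hx : StrictMono x) (hc : ∀ j, 0 ≤ c j)
    (hc' : ∃ j, c j ≠ 0) {f : ℝ[X]} (hf : f ≠ 0) :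
    0 < integralFunctional (weight α c x) (f * f) := by
  rw [weightFunctional_apply hα hx, integral_mul_weight hα (f * f).continuous hx]
  have hnn : ∀ j u, 0 ≤ (f * f).eval u * gapProd α x j u := fun j u => by
    rw [eval_mul]
    exact mul_nonneg (mul_self_nonneg _) (Finset.prod_nonneg fun k _ => truncPow_nonneg _ _ _)
  obtain ⟨j, hj⟩ := hc'
  refine Finset.sum_pos' (fun i _ => mul_nonneg (hc i) (integral_nonneg (hnn i)))
    ⟨j, Finset.mem_univ j, mul_pos (lt_of_le_of_ne (hc j) hj.symm) ?_⟩
  -- a point of the gap at which `f` does not vanish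
  obtain ⟨u, hu, hfu⟩ : ∃ u ∈ Ioo (x j.castSucc) (x j.succ), f.eval u ≠ 0 := by
    by_contra! h
    exact hf (eq_zero_of_infinite_isRoot f ((Ioo_infinite (hx (Fin.castSucc_lt_succ))).mono h))
  obtain ⟨R, -, hR⟩ := exists_bound x
  refine Continuous.integral_pos_of_hasCompactSupport_nonneg_nonzero (x := u)
    ((f * f).continuous.mul (continuous_gapProd hα j)) ?_ (hnn j) ?_
  · refine HasCompactSupport.intro (isCompact_Icc (a := -R) (b := R)) fun v hv => ?_
    rw [mem_Icc, ← abs_le, not_le] at hv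
    rw [gapProd_eq_zero_of_lt_abs hα j hR hv, mul_zero]
  · rw [eval_mul, gapProd_eq_indicator hα hx, indicator_of_mem hu]
    refine mul_ne_zero (mul_ne_zero hfu hfu) (Finset.prod_ne_zero_iff.2 fun k _ => ?_)
    refine (Real.rpow_pos_of_pos (abs_pos.2 (sub_ne_zero.2 ?_)) _).ne'
    rintro rfl
    rcases le_or_gt k j.castSucc with h | h
    · exact absurd hu.1 (not_lt.2 (hx.monotone h))
    · exact absurd hu.2 (not_lt.2 (hx.monotone (Fin.castSucc_lt_iff_succ_le.1 h)))

end functionals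

section motion

variable {M : ℕ} {α : Fin (M + 1) → ℝ} (hα : ∀ k, 0 < α k) {c : Fin M → ℝ}
  {x : Fin (M + 1) → ℝ → ℝ} {x' : Fin (M + 1) → ℝ} {t : ℝ}
  (hx' : ∀ k, HasDerivAt (x k) (x' k) t) (hx : ∀ᶠ s in 𝓝 t, StrictMono fun k => x k s)

include hα hx' hx

lemma hasDerivAt_weightFunctional (q : ℝ[X]) :
    HasDerivAt (fun s => integralFunctional (weight α c fun k => x k s) q)
      (∑ k, x' k * nodeFunctional α c (fun k => x k t) k q) t := by
  have h := HasDerivAt.fun_sum (u := Finset.univ) fun j _ =>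
    (hasDerivAt_integral_gapProd hα q j hx').const_mul (c j)
  refine (h.congr_deriv ?_).congr_of_eventuallyEq (hx.mono fun s hs => ?_)
  · simp_rw [nodeFunctional_apply hα hx.self_of_nhds,
      integral_mul_weight_div hα q.continuous hx.self_of_nhds, Finset.mul_sum]
    rw [Finset.sum_comm]
    exact Finset.sum_congr rfl fun _ _ => Finset.sum_congr rfl fun _ _ => by ring
  · simp only
    rw [weightFunctional_apply hα hs, integral_mul_weight hα q.continuous hs]

lemma hasDerivAt_nodeFunctional_one (i : Fin (M + 1)) :
    HasDerivAt (fun s => nodeFunctional α c (fun k => x k s) i 1)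
      (∑ k ∈ Finset.univ.erase i, (x' i - x' k) / (x i t - x k t) *
        (α k * nodeFunctional α c (fun k => x k t) i 1 -
          α i * nodeFunctional α c (fun k => x k t) k 1)) t := by
  have hxt := hx.self_of_nhds
  have e : ∀ s, StrictMono (fun k => x k s) → ∀ k, nodeFunctional α c (fun k => x k s) k 1 =
      α k * ∑ j, c j * ∫ u, gapProd α (fun k => x k s) j u / (x k s - u) := by
    intro s hs k
    rw [nodeFunctional_apply hα hs, integral_mul_weight_div hα (1 : ℝ[X]).continuous hs]
    simp_rw [eval_one, one_mul]
  have h := (HasDerivAt.fun_sum (u := Finset.univ) fun j _ =>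
    (hasDerivAt_integral_gapProd_div hα j i hx'
      fun k hk h => hk (hxt.injective h)).const_mul (c j)).const_mul (α i)
  refine (h.congr_deriv ?_).congr_of_eventuallyEq (hx.mono fun s hs => e s hs i)
  simp_rw [e t hxt, Finset.mul_sum]
  rw [Finset.sum_comm]
  refine Finset.sum_congr rfl fun _ _ => ?_
  rw [← Finset.sum_sub_distrib, Finset.mul_sum]
  exact Finset.sum_congr rfl fun _ _ => by ring

end motion

/-! ### Orthonormal polynomials by the Gram–Schmidt process -/

lemma monicOrtho_monic (w : ℝ → ℝ) (n : ℕ) :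
    (monicOrtho w n).Monic ∧ (monicOrtho w n).natDegree = n := by
  induction n using Nat.strong_induction_on with
  | _ n ih =>
    have hS : (∑ k : Fin n, C (polyInner w (X ^ n) (monicOrtho w k) /
        polyInner w (monicOrtho w k) (monicOrtho w k)) * monicOrtho w k).degree < n := by
      rw [degree_lt_iff_coeff_zero]
      intro m hm
      rw [finsetSum_coeff]
      refine Finset.sum_eq_zero fun k _ => ?_
      rw [coeff_C_mul, coeff_eq_zero_of_natDegree_lt (by rw [(ih k k.2).2]; omega), mul_zero]
    rw [monicOrtho]
    refine ⟨monic_X_pow_sub hS, natDegree_eq_of_degree_eq_some ?_⟩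
    rw [degree_sub_eq_left_of_degree_lt (by rwa [degree_X_pow]), degree_X_pow]

section gramSchmidt

variable {w : ℝ → ℝ} (hw : ∀ q : ℝ[X], Integrable fun u => q.eval u * w u)
  (hpos : ∀ f : ℝ[X], f ≠ 0 → 0 < integralFunctional w (f * f))

include hw hpos

lemma polyInner_monicOrtho_self_pos (n : ℕ) :
    0 < polyInner w (monicOrtho w n) (monicOrtho w n) := by
  rw [polyInner_eq hw]; exact hpos _ (monicOrtho_monic w n).1.ne_zero

lemma integralFunctional_monicOrtho_of_lt {n k : ℕ} (hk : k < n) :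
    integralFunctional w (monicOrtho w n * monicOrtho w k) = 0 := by
  induction n using Nat.strong_induction_on generalizing k with
  | _ n ih =>
    conv_lhs => rw [monicOrtho]
    rw [sub_mul, map_sub, Finset.sum_mul, map_sum, Finset.sum_eq_single ⟨k, hk⟩]
    · rw [mul_assoc, map_C_mul, ← polyInner_eq hw, ← polyInner_eq hw,
        div_mul_cancel₀ _ (polyInner_monicOrtho_self_pos hw hpos k).ne', sub_self]
    · intro i _ hi
      rw [mul_assoc, map_C_mul]
      rcases lt_trichotomy (i : ℕ) k with h | h | h
      · rw [mul_comm (monicOrtho w i), ih k hk h, mul_zero]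
      · exact absurd (Fin.ext h) hi
      · rw [ih i i.2 h, mul_zero]
    · simp

lemma isOrthonormal_ortho : IsOrthonormal (integralFunctional w) (ortho w) := by
  have hs : ∀ n, 0 < (Real.sqrt (polyInner w (monicOrtho w n) (monicOrtho w n)))⁻¹ := fun n =>
    inv_pos.2 (Real.sqrt_pos.2 (polyInner_monicOrtho_self_pos hw hpos n))
  refine ⟨fun n => ?_, fun n => ?_, fun i j => ?_⟩
  · rw [ortho, natDegree_C_mul (hs n).ne', (monicOrtho_monic w n).2]
  · rw [ortho, leadingCoeff_mul, leadingCoeff_C, (monicOrtho_monic w n).1.leadingCoeff, mul_one]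
    exact hs n
  · have e : ortho w i * ortho w j =
        C ((Real.sqrt (polyInner w (monicOrtho w i) (monicOrtho w i)))⁻¹ *
          (Real.sqrt (polyInner w (monicOrtho w j) (monicOrtho w j)))⁻¹) *
        (monicOrtho w i * monicOrtho w j) := by
      rw [ortho, ortho, C_mul]; ring
    rw [e, map_C_mul]
    rcases lt_trichotomy i j with h | rfl | h
    · rw [mul_comm (monicOrtho w i), integralFunctional_monicOrtho_of_lt hw hpos h, mul_zero,
        if_neg h.ne]
    · rw [if_pos rfl, ← polyInner_eq hw, ← mul_inv,
        Real.mul_self_sqrt (polyInner_monicOrtho_self_pos hw hpos i).le,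
        inv_mul_cancel₀ (polyInner_monicOrtho_self_pos hw hpos i).ne']
    · rw [integralFunctional_monicOrtho_of_lt hw hpos h, mul_zero, if_neg h.ne']

lemma isOrthonormalSeq_ortho : IsOrthonormalSeq w (ortho w) := by
  have h := isOrthonormal_ortho hw hpos
  refine ⟨h.natDegree_eq, h.leadingCoeff_pos, fun i j => ?_, fun i j => ?_⟩
  · simpa only [eval_mul] using hw (ortho w i * ortho w j)
  · rw [polyInner_eq hw, h.map_mul]

lemma isThreeTerm_ortho : IsThreeTerm (ortho w) (recA w) (recB w) :=
  (isOrthonormal_ortho hw hpos).isThreeTerm rfl (fun _ => polyInner_eq hw _ _)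
    fun _ => polyInner_eq hw _ _

end gramSchmidt

/-! ### Orthonormal polynomials depending on a parameter -/

/-- Coefficientwise differentiability at `t` of a family of polynomials of bounded degree. -/
structure PolyHasDerivAt (f : ℝ → ℝ[X]) (f' : ℝ[X]) (t : ℝ) : Prop where
  bounded : ∃ N, ∀ s, (f s).natDegree ≤ N
  coeff : ∀ i, HasDerivAt (fun s => (f s).coeff i) (f'.coeff i) t

namespace PolyHasDerivAt

variable {f g : ℝ → ℝ[X]} {f' g' : ℝ[X]} {t : ℝ}

lemma const (q : ℝ[X]) (t : ℝ) : PolyHasDerivAt (fun _ => q) 0 t :=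
  ⟨⟨_, fun _ => le_rfl⟩, fun i => by simpa using hasDerivAt_const t (q.coeff i)⟩

lemma sub (hf : PolyHasDerivAt f f' t) (hg : PolyHasDerivAt g g' t) :
    PolyHasDerivAt (fun s => f s - g s) (f' - g') t := by
  obtain ⟨N, hN⟩ := hf.bounded
  obtain ⟨K, hK⟩ := hg.bounded
  refine ⟨⟨max N K, fun s => natDegree_sub_le_of_le (hN s) (hK s)⟩, fun i => ?_⟩
  simp_rw [coeff_sub]
  exact (hf.coeff i).sub (hg.coeff i)

lemma sum {ι : Type*} {S : Finset ι} {F : ι → ℝ → ℝ[X]} {F' : ι → ℝ[X]}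
    (hF : ∀ k ∈ S, PolyHasDerivAt (F k) (F' k) t) :
    PolyHasDerivAt (fun s => ∑ k ∈ S, F k s) (∑ k ∈ S, F' k) t := by
  choose! N hN using fun k hk => (hF k hk).bounded
  refine ⟨⟨S.sup N, fun s => natDegree_sum_le_of_forall_le _ _ fun k hk =>
    (hN k hk s).trans (Finset.le_sup hk)⟩, fun i => ?_⟩
  simp_rw [finsetSum_coeff]
  exact HasDerivAt.fun_sum fun k hk => (hF k hk).coeff i

lemma C_mul {r : ℝ → ℝ} {r' : ℝ} (hr : HasDerivAt r r' t) (hf : PolyHasDerivAt f f' t) :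
    PolyHasDerivAt (fun s => C (r s) * f s) (C r' * f t + C (r t) * f') t := by
  obtain ⟨N, hN⟩ := hf.bounded
  refine ⟨⟨N, fun s => (natDegree_C_mul_le _ _).trans (hN s)⟩, fun i => ?_⟩
  simp_rw [coeff_add, coeff_C_mul]
  exact hr.mul (hf.coeff i)

lemma mul (hf : PolyHasDerivAt f f' t) (hg : PolyHasDerivAt g g' t) :
    PolyHasDerivAt (fun s => f s * g s) (f' * g t + f t * g') t := by
  obtain ⟨N, hN⟩ := hf.bounded
  obtain ⟨K, hK⟩ := hg.bounded
  refine ⟨⟨N + K, fun s => natDegree_mul_le.trans (add_le_add (hN s) (hK s))⟩, fun i => ?_⟩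
  simp_rw [coeff_add, coeff_mul, ← Finset.sum_add_distrib]
  exact HasDerivAt.fun_sum fun k _ => (hf.coeff k.1).mul (hg.coeff k.2)

/-- The product rule for a polynomial family under a differentiable family of functionals. -/
lemma map {Λ : ℝ → ℝ[X] →ₗ[ℝ] ℝ} {Λ' : ℝ[X] →ₗ[ℝ] ℝ}
    (hΛ : ∀ q, HasDerivAt (fun s => Λ s q) (Λ' q) t) (hf : PolyHasDerivAt f f' t) :
    HasDerivAt (fun s => Λ s (f s)) (Λ t f' + Λ' (f t)) t := by
  obtain ⟨N, hN⟩ := hf.bounded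
  set K := max N f'.natDegree + 1 with hK
  have e : ∀ (L : ℝ[X] →ₗ[ℝ] ℝ) (q : ℝ[X]), q.natDegree < K →
      L q = ∑ i ∈ Finset.range K, q.coeff i * L (X ^ i) := by
    intro L q hq
    conv_lhs => rw [q.as_sum_range_C_mul_X_pow' hq, map_sum]
    exact Finset.sum_congr rfl fun i _ => map_C_mul L _ _
  have hfs : ∀ s, (f s).natDegree < K := fun s =>
    Nat.lt_succ_of_le ((hN s).trans (le_max_left _ _))
  have h := HasDerivAt.fun_sum (u := Finset.range K) fun i _ => (hf.coeff i).mul (hΛ (X ^ i))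
  rw [Finset.sum_add_distrib, ← e _ f' (Nat.lt_succ_of_le (le_max_right _ _)),
    ← e _ (f t) (hfs t)] at h
  exact h.congr_of_eventuallyEq (Eventually.of_forall fun s => e _ _ (hfs s))

end PolyHasDerivAt

section parameter

variable {w : ℝ → ℝ → ℝ} {Λ' : ℝ[X] →ₗ[ℝ] ℝ} {t : ℝ}

lemma exists_polyHasDerivAt_ortho
    (hw : ∀ᶠ s in 𝓝 t, ∀ q : ℝ[X], Integrable fun u => q.eval u * w s u)
    (hpos : ∀ f : ℝ[X], f ≠ 0 → 0 < integralFunctional (w t) (f * f))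
    (hΛ : ∀ q, HasDerivAt (fun s => integralFunctional (w s) q) (Λ' q) t) (n : ℕ) :
    ∃ q, PolyHasDerivAt (fun s => ortho (w s) n) q t := by
  have hinner : ∀ {f g : ℝ → ℝ[X]} {f' g' : ℝ[X]}, PolyHasDerivAt f f' t → PolyHasDerivAt g g' t →
      ∃ r, HasDerivAt (fun s => polyInner (w s) (f s) (g s)) r t := fun hf hg =>
    ⟨_, ((hf.mul hg).map hΛ).congr_of_eventuallyEq
      (hw.mono fun s hs => polyInner_eq hs _ _)⟩
  have hne := fun n => (polyInner_monicOrtho_self_pos hw.self_of_nhds hpos n).ne'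
  have hmonic : ∀ n, ∃ q, PolyHasDerivAt (fun s => monicOrtho (w s) n) q t := by
    intro n
    induction n using Nat.strong_induction_on with
    | _ n ih =>
      choose q hq using fun k : Fin n => ih k k.2
      choose r hr using fun k : Fin n => hinner (PolyHasDerivAt.const (X ^ n) t) (hq k)
      choose r' hr' using fun k : Fin n => hinner (hq k) (hq k)
      have h := (PolyHasDerivAt.const (X ^ n) t).sub
        (PolyHasDerivAt.sum (S := Finset.univ) fun k _ =>
          PolyHasDerivAt.C_mul ((hr k).div (hr' k) (hne k)) (hq k))
      have e : (fun s => monicOrtho (w s) n) = fun s => X ^ n - ∑ k : Fin n,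
          C (polyInner (w s) (X ^ n) (monicOrtho (w s) k) /
            polyInner (w s) (monicOrtho (w s) k) (monicOrtho (w s) k)) * monicOrtho (w s) k :=
        funext fun s => by rw [monicOrtho]
      rw [e]
      exact ⟨_, h⟩
  obtain ⟨q, hq⟩ := hmonic n
  obtain ⟨r, hr⟩ := hinner hq hq
  exact ⟨_, PolyHasDerivAt.C_mul ((hr.sqrt (hne n)).inv
    (Real.sqrt_ne_zero'.2 (polyInner_monicOrtho_self_pos hw.self_of_nhds hpos n))) hq⟩

variable {Λ : ℝ → ℝ[X] →ₗ[ℝ] ℝ} {p : ℕ → ℝ → ℝ[X]} {q : ℕ → ℝ[X]}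
  (hΛ : ∀ q, HasDerivAt (fun s => Λ s q) (Λ' q) t)
  (hp : ∀ᶠ s in 𝓝 t, IsOrthonormal (Λ s) (p · s)) (hq : ∀ n, PolyHasDerivAt (p n) (q n) t)

include hΛ hp hq

/-- Differentiating `Λ (p_n p_m) = δ_nm`. -/
lemma map_deriv_add_map_deriv (n m : ℕ) :
    Λ t (q n * p m t) + Λ t (p n t * q m) + Λ' (p n t * p m t) = 0 := by
  have h1 := ((hq n).mul (hq m)).map hΛ
  rw [map_add] at h1
  refine h1.unique ((hasDerivAt_const t (if n = m then (1 : ℝ) else 0)).congr_of_eventuallyEq ?_)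
  exact hp.mono fun s hs => hs.map_mul n m

omit hΛ in
lemma natDegree_deriv_le (n : ℕ) : (q n).natDegree ≤ n := by
  rw [natDegree_le_iff_coeff_eq_zero]
  intro i hi
  refine ((hq n).coeff i).unique ((hasDerivAt_const t (0 : ℝ)).congr_of_eventuallyEq ?_)
  exact hp.mono fun s hs => coeff_eq_zero_of_natDegree_lt (by rwa [hs.natDegree_eq])

lemma hasDerivAt_leadingCoeff (n : ℕ) :
    HasDerivAt (fun s => (p n s).leadingCoeff)
      ((p n t).leadingCoeff * (-(1 / 2) * Λ' (p n t * p n t))) t := by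
  have hpt := hp.self_of_nhds
  refine (((hq n).coeff n).congr_of_eventuallyEq
    (hp.mono fun s hs => (hs.coeff_self n).symm)).congr_deriv ?_
  have h1 := map_deriv_add_map_deriv hΛ hp hq n n
  rw [mul_comm (p n t) (q n),
    hpt.map_mul_of_natDegree_le (natDegree_deriv_le hp hq n)] at h1
  have h0 := (hpt.leadingCoeff_pos n).ne'
  field_simp at h1 ⊢
  linarith

variable {a b : ℕ → ℝ → ℝ}

lemma hasDerivAt_recA (n : ℕ) (ha : ∀ᶠ s in 𝓝 t, a (n + 1) s = Λ s (X * p n s * p (n + 1) s)) :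
    HasDerivAt (a (n + 1))
      (a (n + 1) t * (1 / 2 * (Λ' (p (n + 1) t * p (n + 1) t) - Λ' (p n t * p n t)))) t := by
  have hpt := hp.self_of_nhds
  have e : ∀ᶠ s in 𝓝 t, a (n + 1) s = (p n s).leadingCoeff / (p (n + 1) s).leadingCoeff :=
    (hp.and ha).mono fun s hs => by rw [hs.2]; exact hs.1.map_X_mul_succ n
  have h0 := (hpt.leadingCoeff_pos n).ne'
  have h1 := (hpt.leadingCoeff_pos (n + 1)).ne'
  refine (((hasDerivAt_leadingCoeff hΛ hp hq n).div (hasDerivAt_leadingCoeff hΛ hp hq (n + 1))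
    h1).congr_of_eventuallyEq e).congr_deriv ?_
  rw [e.self_of_nhds]
  field_simp
  ring

lemma hasDerivAt_recB (hab : ∀ᶠ s in 𝓝 t, IsThreeTerm (p · s) (a · s) (b · s)) (n : ℕ)
    (hb : ∀ᶠ s in 𝓝 t, b n s = Λ s (X * p n s * p n s)) :
    HasDerivAt (b n)
      (a (n + 1) t * Λ' (p (n + 1) t * p n t) - a n t * Λ' (p n t * p (n - 1) t)) t := by
  have hpt := hp.self_of_nhds
  have hX := ((PolyHasDerivAt.const X t).mul (hq n)).mul (hq n)
  refine ((hX.map hΛ).congr_of_eventuallyEq hb).congr_deriv ?_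
  have hr := hab.self_of_nhds.recurrence n
  have e1 : (0 * p n t + X * q n) * p n t + X * p n t * q n =
      C 2 * (C (a (n + 1) t) * (q n * p (n + 1) t) + C (b n t) * (q n * p n t) +
        C (a n t) * (q n * p (n - 1) t)) := by
    have : (C 2 : ℝ[X]) = 2 := rfl
    rw [this]
    linear_combination -2 * q n * hr
  have e2 : X * p n t * p n t = C (a (n + 1) t) * (p (n + 1) t * p n t) +
      C (b n t) * (p n t * p n t) + C (a n t) * (p n t * p (n - 1) t) := by
    linear_combination -p n t * hr
  simp only [e1, e2, map_add, map_C_mul]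
  have hdeg := natDegree_deriv_le hp hq
  rw [hpt.map_mul_of_natDegree_lt (n := n + 1) ((hdeg n).trans_lt (Nat.lt_succ_self n))]
  have h1 := map_deriv_add_map_deriv hΛ hp hq n n
  rw [mul_comm (p n t) (q n)] at h1
  have h2 : a n t * (Λ t (q n * p (n - 1) t) + Λ' (p n t * p (n - 1) t)) = 0 := by
    rcases n with _ | n
    · rw [hab.self_of_nhds.zero, zero_mul]
    · have := map_deriv_add_map_deriv hΛ hp hq (n + 1) n
      rw [mul_comm (p (n + 1) t) (q n),
        hpt.map_mul_of_natDegree_lt (n := n + 1) ((hdeg n).trans_lt (Nat.lt_succ_self n))] at this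
      rw [Nat.add_sub_cancel]
      linear_combination a (n + 1) t * this
  linear_combination b n t * h1 + 2 * h2

end parameter

/-! ### The differential system -/

/-- Division by `W' (x j) W' (x k)` turns values at the nodes into residues. -/
lemma sum_antisymm_div_eq {ι : Type*} [DecidableEq ι] (S : Finset ι) (r N A B : ι → ℝ) (j : ι)
    (hN : ∀ k, N k ≠ 0) :
    ∑ k ∈ S, r k * ((A k * N k * (B j * N j) - A j * N j * (B k * N k)) / (N j * N k)) =
      ∑ k ∈ S, r k * (A k * B j - A j * B k) :=
  Finset.sum_congr rfl fun k _ => by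
    have := hN k; have := hN j
    field_simp

end GenJacobi

/-- The nodes are `x 0 t < ⋯ < x M t` (so there are `m = M + 1` of them) for `t` in an open set
`I`; the exponents `α k > 0` and the constants `c j ≥ 0`, not all zero, do not depend on `t`. -/
theorem mainTheorem1 {M : ℕ} (α : Fin (M + 1) → ℝ) (hα : ∀ k, 0 < α k)
    (c : Fin M → ℝ) (hc : ∀ j, 0 ≤ c j) (hc' : ∃ j, c j ≠ 0)
    (I : Set ℝ) (hI : IsOpen I) (x : Fin (M + 1) → ℝ → ℝ)
    (hx : ∀ t ∈ I, StrictMono fun k => x k t)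
    (x' : Fin (M + 1) → ℝ → ℝ) (hx' : ∀ k, ∀ t ∈ I, HasDerivAt (x k) (x' k t) t)
    -- the weight and the objects attached to it
    (w : ℝ → ℝ → ℝ) (hw : ∀ t, w t = weight α c fun k => x k t)
    (W V : ℝ → ℝ[X]) (hW : ∀ t, W t = nodal fun k => x k t)
    (hV : ∀ t, V t = logDerivNum α fun k => x k t)
    (W' : Fin (M + 1) → ℝ → ℝ) (hW' : ∀ k t, W' k t = nodalDeriv (fun i => x i t) k)
    (p : ℕ → ℝ → ℝ[X]) (hp : ∀ n t, p n t = ortho (w t) n)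
    (γ : ℕ → ℝ → ℝ) (hγ : ∀ n t, γ n t = (p n t).leadingCoeff)
    (a b : ℕ → ℝ → ℝ) (ha : ∀ n t, a n t = recA (w t) n) (hb : ∀ n t, b n t = recB (w t) n) :
    -- the orthonormal polynomials, their recurrence, and the structure polynomials exist
    (∀ t ∈ I, IsOrthonormalSeq (w t) (p · t) ∧ IsThreeTerm (p · t) (a · t) (b · t) ∧
      ∃! S : (ℕ → ℝ[X]) × (ℕ → ℝ[X]),
        IsLaguerreFreud (M + 1) (W t) (V t) (p · t) (a · t) (b · t) S.1 S.2) ∧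
    -- the differential system
    ∀ Ω Θ : ℕ → ℝ → ℝ[X],
      (∀ t ∈ I, IsLaguerreFreud (M + 1) (W t) (V t) (p · t) (a · t) (b · t) (Ω · t) (Θ · t)) →
      ∀ t ∈ I,
        (∀ n, 1 ≤ n → DifferentiableAt ℝ (a n) t ∧
          deriv (a n) t / a n t =
            1 / 2 * ∑ k, ((Θ n t).eval (x k t) - (Θ (n - 1) t).eval (x k t)) * x' k t / W' k t) ∧
        (∀ n, HasDerivAt (b n)
            (∑ k, ((Ω (n + 1) t).eval (x k t) - (Ω n t).eval (x k t)) * x' k t / W' k t) t ∧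
          HasDerivAt (b n)
            (∑ k, ((x k t - b n t) * (Θ n t).eval (x k t) - 2 * (Ω n t).eval (x k t)) * x' k t /
              W' k t) t) ∧
        (∀ n, DifferentiableAt ℝ (γ n) t ∧
          deriv (γ n) t / γ n t = -(1 / 2) * ∑ k, x' k t * (Θ n t).eval (x k t) / W' k t) ∧
        (∀ n j, HasDerivAt (fun s => (Θ n s).eval (x j s) / W' j s)
          (2 * (deriv (γ n) t / γ n t) * ((Θ n t).eval (x j t) / W' j t) -
            2 * ∑ k ∈ Finset.univ.erase j, (x' j t - x' k t) / (x j t - x k t) *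
              (((Θ n t).eval (x k t) * (Ω n t).eval (x j t) -
                (Θ n t).eval (x j t) * (Ω n t).eval (x k t)) / (W' j t * W' k t))) t) ∧
        (∀ n, 1 ≤ n → ∀ j, HasDerivAt (fun s => (Θ (n - 1) s).eval (x j s) / W' j s)
          (-2 * (deriv (γ (n - 1)) t / γ (n - 1) t) * ((Θ (n - 1) t).eval (x j t) / W' j t) +
            2 * ∑ k ∈ Finset.univ.erase j, (x' j t - x' k t) / (x j t - x k t) *
              (((Θ (n - 1) t).eval (x k t) * (Ω n t).eval (x j t) -
                (Θ (n - 1) t).eval (x j t) * (Ω n t).eval (x k t)) / (W' j t * W' k t))) t) ∧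
        -- for `n = 0` the right-hand side is `0`, because `a 0 = 0`
        (∀ n j, HasDerivAt (fun s => (Ω n s).eval (x j s) / W' j s)
          ((a n t) ^ 2 * ∑ k ∈ Finset.univ.erase j, (x' j t - x' k t) / (x j t - x k t) *
            (((Θ n t).eval (x j t) * (Θ (n - 1) t).eval (x k t) -
              (Θ n t).eval (x k t) * (Θ (n - 1) t).eval (x j t)) / (W' j t * W' k t))) t) := by
  have hM : 1 ≤ M := Nat.one_le_iff_ne_zero.2 (by rintro rfl; exact hc'.elim fun j => j.elim0)
  obtain rfl : w = fun t => weight α c fun k => x k t := funext hw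
  obtain rfl : W = fun t => nodal fun k => x k t := funext hW
  obtain rfl : V = fun t => logDerivNum α fun k => x k t := funext hV
  obtain rfl : W' = fun k t => nodalDeriv (fun i => x i t) k :=
    funext fun k => funext fun t => hW' k t
  obtain rfl : p = fun n t => ortho (weight α c fun k => x k t) n :=
    funext fun n => funext fun t => hp n t
  obtain rfl : a = fun n t => recA (weight α c fun k => x k t) n :=
    funext fun n => funext fun t => ha n t
  obtain rfl : b = fun n t => recB (weight α c fun k => x k t) n :=
    funext fun n => funext fun t => hb n t
  clear hw hW hV hW' hp ha hb
  set w := fun t => weight α c fun k => x k t with hw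
  set p := fun n t => ortho (w t) n with hp
  set a := fun n t => recA (w t) n with ha
  set b := fun n t => recB (w t) n with hb
  set T := fun t => nodeFunctional α c fun k => x k t with hT
  have hint : ∀ t ∈ I, ∀ q : ℝ[X], MeasureTheory.Integrable fun u => q.eval u * w t u :=
    fun t ht q => integrable_mul_weight hα q.continuous (hx t ht)
  have hpos : ∀ t ∈ I, ∀ f : ℝ[X], f ≠ 0 → 0 < integralFunctional (w t) (f * f) :=
    fun t ht f hf => weightFunctional_mul_self_pos hα (hx t ht) hc hc' hf
  have hon : ∀ t ∈ I, IsOrthonormal (integralFunctional (w t)) (p · t) :=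
    fun t ht => isOrthonormal_ortho (hint t ht) (hpos t ht)
  have htt : ∀ t ∈ I, IsThreeTerm (p · t) (a · t) (b · t) :=
    fun t ht => isThreeTerm_ortho (hint t ht) (hpos t ht)
  have hTmul : ∀ t ∈ I, ∀ k q, T t k ((C (x k t) - X) * q) = α k * integralFunctional (w t) q :=
    fun t ht k q => nodeFunctional_mul hα (hx t ht) k q
  have hTsum : ∀ t ∈ I, ∀ q, ∑ k, T t k q = integralFunctional (w t) (derivative q) :=
    fun t ht q => sum_nodeFunctional hα (hx t ht) q
  set θ : ℕ → Fin (M + 1) → ℝ → ℝ := fun n k t => resTheta (T t) (p · t) n k with hθ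
  set ω : ℕ → Fin (M + 1) → ℝ → ℝ := fun n k t => resOmega α (T t) (p · t) (a · t) n k with hω
  have hLF : ∀ t ∈ I, IsLaguerreFreud (M + 1) (nodal fun k => x k t)
      (logDerivNum α fun k => x k t) (p · t) (a · t) (b · t)
      (fun n => residuePoly (fun k => x k t) fun k => ω n k t)
      (fun n => residuePoly (fun k => x k t) fun k => θ n k t) := fun t ht =>
    isLaguerreFreud_residuePoly hM (hon t ht) (htt t ht) (hTmul t ht) (hTsum t ht)
  refine ⟨fun t ht => ⟨isOrthonormalSeq_ortho (hint t ht) (hpos t ht), htt t ht,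
    ⟨_, _⟩, hLF t ht, fun S hS => ?_⟩, fun Ω Θ hΩΘ t ht => ?_⟩
  · obtain ⟨h1, h2⟩ := IsLaguerreFreud.unique (hon t ht) (htt t ht) hS (hLF t ht)
    exact Prod.ext h1 h2
  have hW0 : ∀ s ∈ I, ∀ k, nodalDeriv (fun i => x i s) k ≠ 0 := fun s hs k =>
    nodalDeriv_ne_zero (hx s hs).injective k
  have hΩ : ∀ s ∈ I, ∀ n k, (Ω n s).eval (x k s) = ω n k s * nodalDeriv (fun i => x i s) k := by
    intro s hs n k
    rw [congrFun (IsLaguerreFreud.unique (hon s hs) (htt s hs) (hΩΘ s hs) (hLF s hs)).1 n]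
    exact eval_residuePoly (x := fun k => x k s) _ k
  have hΘ : ∀ s ∈ I, ∀ n k, (Θ n s).eval (x k s) = θ n k s * nodalDeriv (fun i => x i s) k := by
    intro s hs n k
    rw [congrFun (IsLaguerreFreud.unique (hon s hs) (htt s hs) (hΩΘ s hs) (hLF s hs)).2 n]
    exact eval_residuePoly (x := fun k => x k s) _ k
  have hI' : ∀ᶠ s in nhds t, s ∈ I := hI.mem_nhds ht
  have hxt : ∀ k, HasDerivAt (x k) (x' k t) t := fun k => hx' k t ht
  have hinj := (hx t ht).injective
  -- the derivative of the functional, and the resulting derivatives of the coefficients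
  set Λ' : ℝ[X] →ₗ[ℝ] ℝ := ∑ k, x' k t • T t k with hΛ'
  have hΛ'a : ∀ q, Λ' q = ∑ k, x' k t * T t k q := fun q => by
    simp [hΛ', LinearMap.sum_apply]
  have hΛ : ∀ q, HasDerivAt (fun s => integralFunctional (w s) q) (Λ' q) t := fun q => by
    rw [hΛ'a]; exact hasDerivAt_weightFunctional hα hxt (hI'.mono hx) q
  choose q hq using exists_polyHasDerivAt_ortho (hI'.mono hint) (hpos t ht) hΛ
  have honE := hI'.mono hon
  have hγ' : ∀ n, HasDerivAt (γ n) (γ n t * (-(1 / 2) * Λ' (p n t * p n t))) t := fun n => by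
    rw [show γ n = fun s => (p n s).leadingCoeff from funext (hγ n)]
    exact hasDerivAt_leadingCoeff (p := p) hΛ honE hq n
  have ha' := fun n => hasDerivAt_recA (p := p) (a := a) hΛ honE hq n
    (hI'.mono fun s hs => polyInner_eq (hint s hs) _ _)
  have hb' := fun n => hasDerivAt_recB (p := p) (a := a) (b := b) hΛ honE hq (hI'.mono htt) n
    (hI'.mono fun s hs => polyInner_eq (hint s hs) _ _)
  have hΛθ : ∀ n, Λ' (p n t * p n t) = ∑ k, x' k t * θ n k t := fun n => hΛ'a _
  simp only [hΛθ] at hγ' ha'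
  have hbω : ∀ n, HasDerivAt (b n) (∑ k, x' k t * (ω (n + 1) k t - ω n k t)) t := fun n => by
    refine (hb' n).congr_deriv ?_
    rw [hΛ'a, hΛ'a, Finset.mul_sum, Finset.mul_sum, ← Finset.sum_sub_distrib]
    refine Finset.sum_congr rfl fun k _ => ?_
    simp only [hω, resOmega, Nat.add_sub_cancel]
    ring
  have hγ0 : ∀ n, γ n t ≠ 0 := fun n => by
    rw [hγ]; exact ((hon t ht).leadingCoeff_pos n).ne'
  have hglog : ∀ n, deriv (γ n) t / γ n t = -(1 / 2) * ∑ k, x' k t * θ n k t := fun n => by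
    rw [(hγ' n).deriv, mul_div_cancel_left₀ _ (hγ0 n)]
  -- the case `n = 0` of the system
  have hω0 : ∀ j s, ω 0 j s = α j / 2 := fun j s => by simp [hω, resOmega, ha, recA]
  have hθ0 : ∀ᶠ s in nhds t, ∀ j, θ 0 j s = γ 0 s ^ 2 * T s j 1 := by
    filter_upwards [honE] with s hs j
    have h0 : p 0 s = C (p 0 s).leadingCoeff := by
      conv_lhs => rw [eq_C_of_natDegree_eq_zero (hs.natDegree_eq 0)]
      rw [hs.coeff_self]
    have h1 : p 0 s * p 0 s = C ((p 0 s).leadingCoeff ^ 2) * 1 := by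
      conv_lhs => rw [h0]
      rw [C_pow, mul_one, sq]
    simp only [hθ, resTheta]
    rw [h1, map_C_mul, hγ]
  have hθ0' : ∀ j, HasDerivAt (θ 0 j) (-(∑ k, x' k t * θ 0 k t) * θ 0 j t -
      2 * ∑ k ∈ Finset.univ.erase j, (x' j t - x' k t) / (x j t - x k t) *
        (θ 0 k t * ω 0 j t - θ 0 j t * ω 0 k t)) t := by
    intro j
    have h1 := ((hγ' 0).pow 2).mul (hasDerivAt_nodeFunctional_one hα hxt (hI'.mono hx) (c := c) j)
    refine (h1.congr_of_eventuallyEq (hθ0.mono fun s hs => hs j)).congr_deriv ?_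
    have e : 2 * ∑ k ∈ Finset.univ.erase j, (x' j t - x' k t) / (x j t - x k t) *
        (θ 0 k t * ω 0 j t - θ 0 j t * ω 0 k t) = -γ 0 t ^ 2 *
        ∑ k ∈ Finset.univ.erase j, (x' j t - x' k t) / (x j t - x k t) *
          (α k * T t j 1 - α j * T t k 1) := by
      rw [Finset.mul_sum, Finset.mul_sum]
      refine Finset.sum_congr rfl fun k _ => ?_
      rw [hω0, hω0, hθ0.self_of_nhds, hθ0.self_of_nhds]
      ring
    rw [e, hθ0.self_of_nhds j]
    simp only [Pi.pow_apply]
    push_cast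
    ring
  have hsys := hasDerivAt_residues (θ := θ) (ω := ω) (a := a) (b := b) hxt hinj (fun s => rfl)
    (fun n => ((htt t ht).pos n).ne')
    (hI'.mono fun s hs n k => resOmega_succ (hon s hs) (htt s hs) (hTmul s hs) n k)
    (hI'.mono fun s hs n k => resTheta_succ (hon s hs) (htt s hs) (hTmul s hs) n k)
    (sum_resTheta (hon t ht) (hTsum t ht))
    (sum_resOmega_succ_sub (hon t ht) (htt t ht) (hTsum t ht)) ha' hbω hθ0'
    (fun j => (hasDerivAt_const t (α j / 2)).congr_of_eventuallyEq
      (Filter.Eventually.of_forall (hω0 j)))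
  have hΘdiv : ∀ n j, (fun s => (Θ n s).eval (x j s) / nodalDeriv (fun i => x i s) j) =ᶠ[nhds t]
      θ n j := fun n j => hI'.mono fun s hs => by
    simp only; rw [hΘ s hs, mul_div_cancel_right₀ _ (hW0 s hs j)]
  have hΩdiv : ∀ n j, (fun s => (Ω n s).eval (x j s) / nodalDeriv (fun i => x i s) j) =ᶠ[nhds t]
      ω n j := fun n j => hI'.mono fun s hs => by
    simp only; rw [hΩ s hs, mul_div_cancel_right₀ _ (hW0 s hs j)]
  simp only [hΩ t ht, hΘ t ht, mul_div_cancel_right₀ _ (hW0 t ht _)]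
  have hW0' := hW0 t ht
  refine ⟨fun n hn => ?_, fun n => ?_, fun n => ?_, fun n j => ?_, fun n hn j => ?_, fun n j => ?_⟩
  · obtain ⟨n, rfl⟩ := Nat.exists_eq_add_of_le' hn
    refine ⟨(ha' n).differentiableAt, ?_⟩
    rw [(ha' n).deriv, mul_div_cancel_left₀ _ ((htt t ht).pos n).ne', Nat.add_sub_cancel,
      ← Finset.sum_sub_distrib]
    congr 1
    refine Finset.sum_congr rfl fun k _ => ?_
    have := hW0' k
    field_simp
  · have e1 : ∑ k, x' k t * (ω (n + 1) k t - ω n k t) =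
        ∑ k, (ω (n + 1) k t * nodalDeriv (fun i => x i t) k -
          ω n k t * nodalDeriv (fun i => x i t) k) * x' k t / nodalDeriv (fun i => x i t) k :=
      Finset.sum_congr rfl fun k _ => by
        have := hW0' k
        field_simp
    have e2 : ∑ k, x' k t * (ω (n + 1) k t - ω n k t) =
        ∑ k, ((x k t - b n t) * (θ n k t * nodalDeriv (fun i => x i t) k) -
          2 * (ω n k t * nodalDeriv (fun i => x i t) k)) * x' k t /
            nodalDeriv (fun i => x i t) k :=
      Finset.sum_congr rfl fun k _ => by
        have := hW0' k
        have h1 : ω (n + 1) k t = (x k t - b n t) * θ n k t - ω n k t :=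
          resOmega_succ (hon t ht) (htt t ht) (hTmul t ht) n k
        rw [h1]
        field_simp
        ring
    exact ⟨(hbω n).congr_deriv e1, (hbω n).congr_deriv e2⟩
  · refine ⟨(hγ' n).differentiableAt, ?_⟩
    rw [hglog]
    congr 1
    refine Finset.sum_congr rfl fun k _ => ?_
    rw [← mul_assoc, mul_div_cancel_right₀ _ (hW0' k)]
  · refine (((hsys n).1 j).congr_of_eventuallyEq (hΘdiv n j)).congr_deriv ?_
    rw [sum_antisymm_div_eq _ _ _ (fun k => θ n k t) (fun k => ω n k t) j hW0', hglog]
    congr 1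
    ring
  · refine (((hsys (n - 1)).2.1 j).congr_of_eventuallyEq (hΘdiv (n - 1) j)).congr_deriv ?_
    rw [sum_antisymm_div_eq _ _ _ (fun k => θ (n - 1) k t) (fun k => ω n k t) j hW0',
      Nat.sub_add_cancel hn, hglog]
    congr 1
    ring
  · refine (((hsys n).2.2 j).congr_of_eventuallyEq (hΩdiv n j)).congr_deriv ?_
    rw [Finset.mul_sum]
    refine Finset.sum_congr rfl fun k _ => ?_
    have := hW0' k; have := hW0' j
    field_simp
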